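/- \textbf{Notation.} $C$ is the space of continuous $2\pi$-periodic functions $f:\mathbb R\to\mathbb R$ with $\|f\|_C=\max_t|f(t)|$; for $1\le p<\infty$, $L_p$ is the space of $2\pi$-periodic real functions with $\|\varphi\|_p=\big(\int_0^{2\pi}|\varphi(t)|^p\,dt\big)^{1/p}<\infty$; $a_k(f)=\frac1\pi\int_0^{2\pi}f(t)\cos kt\,dt$ and $b_k(f)=\frac1\pi\int_0^{2\pi}f(t)\sin kt\,dt$. For $\psi:[1,\infty)\to(0,\infty)$ and $\beta\in\mathbb R$, the class $C^\psi_{\beta,p}$ consists of all $f\in C$ for which there is $\varphi\in L_p$ with $\|\varphi\|_p\le1$ whose Fourier series is $$\sum_{k=1}^\infty\frac1{\psi(k)}\Big(a_k(f)\cos\big(kx+\tfrac{\beta\pi}2\big)+b_k(f)\sin\big(kx+\tfrac{\beta\pi}2\big)\Big).$$ For $n\in\mathbb N=\{1,2,\dots\}$ let $$\sigma_{n-1}(f;t)=\frac{a_0(f)}2+\sum_{k=1}^{n-1}\Big(1-\frac kn\Big)\big(a_k(f)\cos kt+b_k(f)\sin kt\big)$$ be the Fejér sums, and let $$E_n(C^\psi_{\beta,p})_C=\sup_{f\in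 C^\psi_{\beta,p}}\ \inf_{T}\|f-T\|_C,\qquad \mathcal E(C^\psi_{\beta,p};\sigma_{n-1})_C=\sup_{f\in C^\psi_{\beta,p}}\|f-\sigma_{n-1}(f;\cdot)\|_C,$$ where $T$ runs over the real trigonometric polynomials of order at most $n-1$. $\mathfrak M_0$ is the set of positive continuous convex functions $g$ on $[1,\infty)$ with $\lim_{t\to\infty}g(t)=0$ such that $\alpha(g;t):=\frac{g(t)}{t|g'(t+0)|}$ satisfies $\alpha(g;t)\ge K$ for all $t\ge1$ and some constant $K>0$. A non-negative sequence $(a_k)_{k\ge1}$ belongs to $GM^+$ if there is $A\ge1$ such that $a_{l}+\sum_{k=l}^{m-1}|a_k-a_{k+1}|\le A\,a_m$ for all $1\le l\le m$; it belongs to $GA^+$ if there are $\varepsilon>0$ and $K$ such that $a_l\,l^{-\varepsilon}\le K a_m\,m^{-\varepsilon}$ for all $1\le l\le m$. Put $g_\delta(t)=\psi(t)t^\delta$. We write $A(n)\asymp B(n)$ if there are constants $K_1,K_2>0$, independent of $n$, with $A(n)\le K_1B(n)$ and $B(n)\le K_2A(n)$ for all $n\in\mathbb N$. \textbf{Proposition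 1.} Let $1\le p<\infty$, $g_{1/p}\in\mathfrak M_0$, $(g_{1+1/p}(k))_{k\ge1}\in GM^+\cap GA^+$ and $\beta\in\mathbb R$. (i) If $1<p<\infty$, $\frac1p+\frac1{p'}=1$, $\sum_{k=1}^\infty\psi^{p'}(k)k^{p'-2}<\infty$ and $\inf_{t\ge1}\alpha(g_{1/p};t)>\frac{p'}2$, then $$E_n(C^\psi_{\beta,p})_C\asymp\mathcal E(C^\psi_{\beta,p};\sigma_{n-1})_C\asymp\Big(\sum_{k=n}^\infty\psi^{p'}(k)k^{p'-2}\Big)^{1/p'}.$$ (ii) If $p=1$, $\sum_{k=1}^\infty\psi(k)<\infty$ and $\inf_{t\ge1}\alpha(g_1;t)>1$, then $$E_n(C^\psi_{\beta,1})_C\asymp\mathcal E(C^\psi_{\beta,1};\sigma_{n-1})_C\asymp\begin{cases}\displaystyle\sum_{k=n}^\infty\psi(k),&\cos\frac{\beta\pi}2\ne0,\\[1ex]\psi(n)\,n,&\cos\frac{\beta\pi}2=0.\end{cases}$$ -/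

import Mathlib

open scoped ENNReal NNReal

noncomputable section

namespace FejerApprox

/-- Fourier cosine coefficient `a_k(f) = (1/π) ∫_0^{2π} f(t) cos(kt) dt`. -/
def fourierCos (f : ℝ → ℝ) (k : ℕ) : ℝ :=
  (1 / Real.pi) * ∫ t in (0 : ℝ)..(2 * Real.pi), f t * Real.cos (k * t)

/-- Fourier sine coefficient `b_k(f) = (1/π) ∫_0^{2π} f(t) sin(kt) dt`. -/
def fourierSin (f : ℝ → ℝ) (k : ℕ) : ℝ :=
  (1 / Real.pi) * ∫ t in (0 : ℝ)..(2 * Real.pi), f t * Real.sin (k * t)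

/-- The norm `‖f‖_p` over one period, for a real exponent `p ≥ 1` (the integral is not
normalized). -/
def periodNorm (p : ℝ) (f : ℝ → ℝ) : ℝ≥0∞ :=
  MeasureTheory.eLpNorm f (ENNReal.ofReal p)
    (MeasureTheory.volume.restrict (Set.Ioc 0 (2 * Real.pi)))

/-- The space `L_p` of `2π`-periodic functions. -/
def PeriodicLp (p : ℝ) (f : ℝ → ℝ) : Prop :=
  Function.Periodic f (2 * Real.pi) ∧
    MeasureTheory.MemLp f (ENNReal.ofReal p)
      (MeasureTheory.volume.restrict (Set.Ioc 0 (2 * Real.pi)))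

/-- The unit ball `U_p` of `L_p`. -/
def unitBall (p : ℝ) : Set (ℝ → ℝ) :=
  {φ | PeriodicLp p φ ∧ periodNorm p φ ≤ 1}

/-- `φ ∈ L_1` is a `(ψ,β)`-derivative of `f`: the series
`∑_{k ≥ 1} (1/ψ(k)) (a_k(f) cos(kx + βπ/2) + b_k(f) sin(kx + βπ/2))`
is, harmonic by harmonic, the Fourier series of `φ` (so the free term of the latter is zero). -/
def IsPsiBetaDerivative (ψ : ℝ → ℝ) (β : ℝ) (f φ : ℝ → ℝ) : Prop :=
  PeriodicLp 1 φ ∧ fourierCos φ 0 = 0 ∧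
    ∀ k : ℕ, 1 ≤ k → ∀ x : ℝ,
      (1 / ψ k) * (fourierCos f k * Real.cos (k * x + β * Real.pi / 2)
          + fourierSin f k * Real.sin (k * x + β * Real.pi / 2))
        = fourierCos φ k * Real.cos (k * x) + fourierSin φ k * Real.sin (k * x)

/-- The class `C^ψ_{β,p}`: continuous `2π`-periodic functions whose `(ψ,β)`-derivative lies in the
unit ball of `L_p`. -/
def psiBetaClass (ψ : ℝ → ℝ) (β p : ℝ) : Set (ℝ → ℝ) :=
  {f | Continuous f ∧ Function.Periodic f (2 * Real.pi) ∧
    ∃ φ ∈ unitBall p, IsPsiBetaDerivative ψ β f φ}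

/-- The uniform norm, with values in `[0, ∞]`. -/
def uniformNorm (f : ℝ → ℝ) : ℝ≥0∞ := ⨆ x, ‖f x‖ₑ

/-- The subspace `𝒯_{2n-1}` of real trigonometric polynomials of order at most `n - 1`
(for `n ≥ 1`). -/
def trigPoly (n : ℕ) : Set (ℝ → ℝ) :=
  {T | ∃ a b : ℕ → ℝ, ∀ x,
    T x = a 0 + ∑ k ∈ Finset.Ico 1 n, (a k * Real.cos (k * x) + b k * Real.sin (k * x))}

/-- The Fejér sum `σ_{n-1}(f; ·)` (for `n ≥ 1`). -/
def fejerSum (n : ℕ) (f : ℝ → ℝ) : ℝ → ℝ := fun x =>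
  fourierCos f 0 / 2 + ∑ k ∈ Finset.Ico 1 n,
    (1 - (k : ℝ) / n) * (fourierCos f k * Real.cos (k * x) + fourierSin f k * Real.sin (k * x))

/-- `E_n(𝔑)_C`: the best uniform approximation of the class `𝔑` by trigonometric polynomials of
order at most `n - 1`. -/
def bestApprox (N : Set (ℝ → ℝ)) (n : ℕ) : ℝ≥0∞ :=
  ⨆ f ∈ N, ⨅ T ∈ trigPoly n, uniformNorm (fun x => f x - T x)

/-- `𝓔(𝔑; σ_{n-1})_C`: the largest uniform deviation of Fejér sums on the class `𝔑`. -/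
def fejerDeviation (N : Set (ℝ → ℝ)) (n : ℕ) : ℝ≥0∞ :=
  ⨆ f ∈ N, uniformNorm (fun x => f x - fejerSum n f x)

/-- `𝔐`: positive continuous convex functions on `[1, ∞)` that tend to zero at infinity. -/
def ClassM (g : ℝ → ℝ) : Prop :=
  (∀ t, 1 ≤ t → 0 < g t) ∧ ContinuousOn g (Set.Ici 1) ∧ ConvexOn ℝ (Set.Ici 1) g ∧
    Filter.Tendsto g Filter.atTop (nhds 0)

/-- `α(g; t) = g(t) / (t |g'(t+0)|)`, with the right-hand derivative. For `g ∈ 𝔐` this derivative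
is negative wherever it is finite; where it is infinite (possible only at `t = 1`) the value is `0`. -/
def alpha (g : ℝ → ℝ) (t : ℝ) : ℝ := g t / (t * |derivWithin g (Set.Ioi t) t|)

/-- `𝔐₀`: the functions `g ∈ 𝔐` for which `α(g; ·)` is bounded below by a positive constant. -/
def ClassM0 (g : ℝ → ℝ) : Prop :=
  ClassM g ∧ ∃ K : ℝ, 0 < K ∧ ∀ t, 1 ≤ t → K ≤ alpha g t

/-- `g_δ(t) = ψ(t) t^δ`. -/
def powerWeight (ψ : ℝ → ℝ) (δ : ℝ) : ℝ → ℝ := fun t => ψ t * t ^ δ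

/-- `GM⁺`: generally monotonically increasing non-negative sequences `(a_k)_{k ≥ 1}`. -/
def GMPlus (a : ℕ → ℝ) : Prop :=
  (∀ k, 1 ≤ k → 0 ≤ a k) ∧ ∃ A : ℝ, 1 ≤ A ∧ ∀ l m : ℕ, 1 ≤ l → l ≤ m →
    a l + ∑ k ∈ Finset.Ico l m, |a k - a (k + 1)| ≤ A * a m

/-- Almost increasing (in the sense of Bernstein) non-negative sequences `(a_k)_{k ≥ 1}`. -/
def AlmostIncreasing (a : ℕ → ℝ) : Prop :=
  (∀ k, 1 ≤ k → 0 ≤ a k) ∧ ∃ K : ℝ, ∀ l m : ℕ, 1 ≤ l → l ≤ m → a l ≤ K * a m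

/-- `GA⁺`: for some `ε > 0` the sequence `a_k k^{-ε}` is almost increasing. -/
def GAPlus (a : ℕ → ℝ) : Prop :=
  ∃ ε : ℝ, 0 < ε ∧ AlmostIncreasing (fun k => a k * (k : ℝ) ^ (-ε))

/-- `A(n) = O(B(n))`, uniformly over all `n ≥ 1`. -/
def BigO (A B : ℕ → ℝ≥0∞) : Prop :=
  ∃ K : ℝ≥0, 0 < K ∧ ∀ n : ℕ, 1 ≤ n → A n ≤ K * B n

/-- `A(n) ≍ B(n)`. -/
def SameOrder (A B : ℕ → ℝ≥0∞) : Prop := BigO A B ∧ BigO B A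

end FejerApprox

end

open FejerApprox

/-! A function of the class is a convolution of its derivative `φ` with `∑ ψ(k) cos(kt - βπ/2) / π`,
so the upper bounds are norms of kernels in the dual space and the lower bounds come from explicit
derivatives `φ`. Write `s = 1/p`. Three facts about `ψ`, collected in `RegularWeight`, suffice:
`ψ(k) k^s` is non-increasing, `ψ` is doubling, and `∑_{k ≤ n} ψ(k) k^s = O(n · ψ(n) n^s)`.

Upper bound. By Fejér's theorem `f - σ_{n-1}` is the limit of `σ_{N-1} - σ_{n-1}`, which splits into
low harmonics weighted by `k/n` and a tail weighted by `1 - k/N`. For `p > 1`, Hölder's inequality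
reduces both to `L_q` norms of cosine sums with monotone coefficients, which the upper
Hardy–Littlewood estimate `exists_integral_abs_sum_cos_rpow_le` controls; the low part also needs
the summation by parts `abs_sum_nat_mul_le`. It contributes `ψ(n) n^{1/p}`, which one dyadic block
of the tail sum dominates. For `p = 1` the dual norm is the supremum: the tail kernel is summed
absolutely, or, when `cos(βπ/2) = 0`, it is a sine sum bounded by `abs_sum_mul_sin_le`.

Lower bound. The mean `2σ_{2n-1} - σ_{n-1}` reproduces polynomials of order below `n` and has norm
at most 3. If every harmonic of `f` is non-negative at `0`, the harmonics from `2n` on therefore sum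
there to at most `4‖f - T‖` (`sum_le_four_mul_of_abs_sub_le`). For `p > 1` the derivative has
amplitudes proportional to `ψ^{q-1} k^{q-2}`, the equality case of Hölder, and is normalized by
Hardy–Littlewood in `L_p`; for `p = 1` it is a translated centred Fejér kernel. -/

namespace FejerApprox

open Finset MeasureTheory Filter Topology

/-! ### Abel summation and cosine sums -/

/-- Abel's inequality: a bounded sequence of partial sums against a non-increasing weight. -/
theorem abs_sum_antitone_mul_le {c e : ℕ → ℝ} {B : ℝ} {m : ℕ} (N : ℕ)
    (hc0 : ∀ k, m ≤ k → 0 ≤ c k) (hc : ∀ k, m ≤ k → c (k + 1) ≤ c k)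
    (hB : ∀ N, |∑ k ∈ Ico m N, e k| ≤ B) :
    |∑ k ∈ Ico m N, c k * e k| ≤ c m * B := by
  have hB0 : 0 ≤ B := (abs_nonneg _).trans (hB 0)
  rcases le_or_gt N m with h | h
  · simpa [Ico_eq_empty_of_le h] using mul_nonneg (hc0 m le_rfl) hB0
  have key : ∀ N, m ≤ N → ∑ k ∈ Ico m N, c k * e k
      = ∑ k ∈ Ico m N, (c k - c (k + 1)) * (∑ j ∈ Ico m (k + 1), e j)
        + c N * ∑ j ∈ Ico m N, e j := by
    intro N hN
    induction N, hN using Nat.le_induction with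
    | base => simp
    | succ N hN ih =>
      rw [sum_Ico_succ_top hN, ih, sum_Ico_succ_top hN, sum_Ico_succ_top hN]
      ring
  -- The weights `c k - c (k + 1)` and `c N` produced by summation by parts are non-negative and add
  -- up to `c m`.
  have tele : ∀ N, m ≤ N → ∑ k ∈ Ico m N, (c k - c (k + 1)) * B + c N * B = c m * B := by
    intro N hN
    induction N, hN using Nat.le_induction with
    | base => simp
    | succ N hN ih => rw [sum_Ico_succ_top hN]; linarith
  rw [key N h.le, ← tele N h.le]
  refine (abs_add_le _ _).trans (add_le_add ((abs_sum_le_sum_abs _ _).trans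
    (sum_le_sum fun k hk => ?_)) ?_)
  · have hk := (mem_Ico.mp hk).1
    rw [abs_mul, abs_of_nonneg (sub_nonneg.mpr (hc k hk))]
    exact mul_le_mul_of_nonneg_left (hB _) (sub_nonneg.mpr (hc k hk))
  · rw [abs_mul, abs_of_nonneg (hc0 N h.le)]
    exact mul_le_mul_of_nonneg_left (hB _) (hc0 N h.le)

/-- Multiplication by `2 sin(u/2)` telescopes the sum to a difference of two sines, and `sin(u/2) ≥
u/π` on this range. The free phase `γ` covers cosines, sines and the shift `βπ/2` at once. -/
theorem abs_sum_cos_le {u : ℝ} (hu : 0 < u) (hu' : u ≤ Real.pi) (γ : ℝ) (m N : ℕ) :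
    |∑ k ∈ Ico m N, Real.cos (k * u - γ)| ≤ Real.pi / u := by
  rcases le_or_gt N m with h | h
  · rw [Ico_eq_empty_of_le h]
    simpa using (div_pos Real.pi_pos hu).le
  have key : ∀ N, m ≤ N → 2 * Real.sin (u / 2) * ∑ k ∈ Ico m N, Real.cos (k * u - γ)
      = Real.sin (N * u - u / 2 - γ) - Real.sin (m * u - u / 2 - γ) := by
    intro N hN
    induction N, hN using Nat.le_induction with
    | base => simp
    | succ N hN ih =>
      rw [sum_Ico_succ_top hN, mul_add, ih]
      have h1 : ((N + 1 : ℕ) : ℝ) * u - u / 2 - γ = (N * u - γ) + u / 2 := by push_cast; ring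
      have h2 : (N : ℝ) * u - u / 2 - γ = (N * u - γ) - u / 2 := by ring
      rw [h1, h2, Real.sin_add, Real.sin_sub]
      ring
  have hs : u / Real.pi ≤ Real.sin (u / 2) := by
    have := Real.mul_le_sin (x := u / 2) (by linarith) (by linarith)
    calc u / Real.pi = 2 / Real.pi * (u / 2) := by ring
      _ ≤ _ := this
  have hs0 : 0 < u / Real.pi := div_pos hu Real.pi_pos
  have h2 : |2 * Real.sin (u / 2) * ∑ k ∈ Ico m N, Real.cos (k * u - γ)| ≤ 2 := by
    rw [key N h.le]
    refine (abs_sub _ _).trans ?_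
    linarith [Real.abs_sin_le_one (N * u - u / 2 - γ), Real.abs_sin_le_one (m * u - u / 2 - γ)]
  rw [abs_mul, abs_mul, abs_two, abs_of_pos (hs0.trans_le hs)] at h2
  have h3 : u / Real.pi * |∑ k ∈ Ico m N, Real.cos (k * u - γ)| ≤ 1 := by
    nlinarith [abs_nonneg (∑ k ∈ Ico m N, Real.cos (k * u - γ))]
  rw [le_div_iff₀ hu]
  rw [div_mul_eq_mul_div, div_le_one Real.pi_pos] at h3
  linarith

theorem abs_sum_mul_cos_le {c : ℕ → ℝ} {u : ℝ} (hu : 0 < u) (hu' : u ≤ Real.pi) (γ : ℝ)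
    {m : ℕ} (N : ℕ) (hc0 : ∀ k, m ≤ k → 0 ≤ c k) (hc : ∀ k, m ≤ k → c (k + 1) ≤ c k) :
    |∑ k ∈ Ico m N, c k * Real.cos (k * u - γ)| ≤ c m * (Real.pi / u) :=
  abs_sum_antitone_mul_le N hc0 hc fun _ => abs_sum_cos_le hu hu' γ m _

/-! ### The Fejér kernel -/

/-- The Fejér kernel, normalized to have mean value one. -/
noncomputable def fejerKernel (N : ℕ) (t : ℝ) : ℝ :=
  1 + 2 * ∑ k ∈ Ico 1 N, (1 - (k : ℝ) / N) * Real.cos (k * t)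

theorem continuous_fejerKernel (N : ℕ) : Continuous (fejerKernel N) := by
  unfold fejerKernel; fun_prop

theorem fejerKernel_periodic (N : ℕ) : Function.Periodic (fejerKernel N) (2 * Real.pi) := by
  intro t
  unfold fejerKernel
  congr 2
  refine sum_congr rfl fun k _ => ?_
  rw [mul_add, Real.cos_add_nat_mul_two_pi]

/-- This is `|∑_{j<N} e^{ijt}|²` split into real and imaginary parts. It yields both positivity and,
through `abs_sum_cos_le` with phases `0` and `π/2`, the decay away from the origin. -/
theorem fejerKernel_mul_eq (N : ℕ) (hN : 1 ≤ N) (t : ℝ) :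
    N * fejerKernel N t = (∑ j ∈ Ico 0 N, Real.cos (j * t - 0)) ^ 2
      + (∑ j ∈ Ico 0 N, Real.cos (j * t - Real.pi / 2)) ^ 2 := by
  have h0 : (N : ℝ) * fejerKernel N t
      = N + 2 * ∑ k ∈ Ico 1 N, ((N : ℝ) - k) * Real.cos (k * t) := by
    unfold fejerKernel
    have : (N : ℝ) ≠ 0 := by positivity
    rw [mul_add, mul_one, mul_left_comm, mul_sum]
    congr 2
    refine sum_congr rfl fun k _ => ?_
    field_simp
  rw [h0]
  simp only [Real.cos_sub_pi_div_two, sub_zero]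
  clear h0
  induction N, hN using Nat.le_induction with
  | base => simp
  | succ N hN ih =>
    have e1 : ∑ k ∈ Ico 1 (N + 1), (((N + 1 : ℕ) : ℝ) - k) * Real.cos (k * t)
        = ∑ k ∈ Ico 1 N, ((N : ℝ) - k) * Real.cos (k * t)
          + ∑ k ∈ Ico 1 (N + 1), Real.cos (k * t) := by
      rw [sum_Ico_succ_top hN, sum_Ico_succ_top hN, ← add_assoc, ← sum_add_distrib]
      congr 1
      · exact sum_congr rfl fun k _ => by push_cast; ring
      · push_cast; ring
    -- The reflection `j ↦ N - j` turns the new cosines into the cross terms of the enlarged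
    -- squares.
    have e2 : ∑ k ∈ Ico 1 (N + 1), Real.cos (k * t)
        = Real.cos (N * t) * ∑ j ∈ Ico 0 N, Real.cos (j * t)
          + Real.sin (N * t) * ∑ j ∈ Ico 0 N, Real.sin (j * t) := by
      have hr := sum_Ico_reflect (fun k : ℕ => Real.cos (k * t)) 0 (Nat.le_succ N)
      rw [Nat.add_sub_cancel_left, Nat.sub_zero] at hr
      rw [mul_sum, mul_sum, ← sum_add_distrib, ← hr]
      refine sum_congr rfl fun k hk => ?_
      rw [← Real.cos_sub, Nat.cast_sub (mem_Ico.mp hk).2.le]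
      congr 1; ring
    rw [e1, e2, sum_Ico_succ_top (Nat.zero_le N), sum_Ico_succ_top (Nat.zero_le N)]
    push_cast
    linear_combination ih - Real.sin_sq_add_cos_sq (N * t)

theorem fejerKernel_nonneg {N : ℕ} (hN : 1 ≤ N) (t : ℝ) : 0 ≤ fejerKernel N t := by
  have h := fejerKernel_mul_eq N hN t
  have hN' : (0 : ℝ) < N := by positivity
  by_contra hneg
  push Not at hneg
  have := mul_neg_of_pos_of_neg hN' hneg
  rw [h] at this
  nlinarith [sq_nonneg (∑ j ∈ Ico 0 N, Real.cos (j * t - 0)),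
    sq_nonneg (∑ j ∈ Ico 0 N, Real.cos (j * t - Real.pi / 2))]

theorem fejerKernel_neg (N : ℕ) (t : ℝ) : fejerKernel N (-t) = fejerKernel N t := by
  simp [fejerKernel]

theorem fejerKernel_le {N : ℕ} (hN : 1 ≤ N) {t δ : ℝ} (hδ : 0 < δ) (h1 : δ ≤ |t|)
    (h2 : |t| ≤ Real.pi) : fejerKernel N t ≤ 2 * (Real.pi / δ) ^ 2 / N := by
  have hN' : (0 : ℝ) < N := by positivity
  have ht : fejerKernel N t = fejerKernel N |t| := by
    rcases abs_choice t with h | h <;> rw [h]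
    rw [fejerKernel_neg]
  have hb : ∀ γ, (∑ j ∈ Ico 0 N, Real.cos (j * |t| - γ)) ^ 2 ≤ (Real.pi / δ) ^ 2 := by
    intro γ
    rw [← sq_abs]
    have h3 := abs_sum_cos_le (hδ.trans_le h1) h2 γ 0 N
    have h4 : Real.pi / |t| ≤ Real.pi / δ := div_le_div_of_nonneg_left Real.pi_pos.le hδ h1
    exact pow_le_pow_left₀ (abs_nonneg _) (h3.trans h4) 2
  rw [ht, le_div_iff₀ hN', mul_comm, fejerKernel_mul_eq N hN]
  linarith [hb 0, hb (Real.pi / 2)]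

/-! ### Hardy's inequality and the Hardy–Littlewood upper bound -/

/-- `∑_{k ≤ M} k^{r-1} = O(M^r)` for `r > 0`. -/
theorem exists_sum_rpow_le {r : ℝ} (hr : 0 < r) :
    ∃ C : ℝ, 0 < C ∧ ∀ M : ℕ, ∑ k ∈ Icc 1 M, (k : ℝ) ^ (r - 1) ≤ C * (M : ℝ) ^ r := by
  have step : ∀ C : ℝ, (∀ k : ℕ, (k + 1 : ℝ) ^ (r - 1) ≤ C * ((k + 1 : ℝ) ^ r - (k : ℝ) ^ r)) →
      ∀ M : ℕ, ∑ k ∈ Icc 1 M, (k : ℝ) ^ (r - 1) ≤ C * (M : ℝ) ^ r := by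
    intro C hC M
    induction M with
    | zero => simp [Real.zero_rpow hr.ne']
    | succ M ih =>
      rw [sum_Icc_succ_top (by lia)]
      have := hC M
      push_cast
      linarith
  have hid : ∀ k : ℕ, (k + 1 : ℝ) ^ (r - 1) = (k + 1 : ℝ) ^ r * (1 / (k + 1)) := by
    intro k
    rw [Real.rpow_sub_one (by positivity)]; ring
  have hk : ∀ k : ℕ, (k : ℝ) ^ r = (k + 1 : ℝ) ^ r * (1 + -(1 / (k + 1))) ^ r := by
    intro k
    have h1 : (0 : ℝ) ≤ 1 + -(1 / (k + 1)) := by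
      have : (1 : ℝ) / (k + 1) ≤ 1 := by rw [div_le_one (by positivity)]; simp
      linarith
    rw [← Real.mul_rpow (by positivity) h1]
    congr 1
    field_simp
    ring
  have hle : ∀ k : ℕ, (1 : ℝ) / (k + 1) ≤ 1 := fun k => by
    rw [div_le_one (by positivity)]; simp
  -- For `r ≤ 1` Bernoulli's inequality gives the constant `1/r`; for `r > 1` raising a number of
  -- `[0,1]` to the power `r` only decreases it, so the constant is 1.
  rcases le_or_gt r 1 with h | h
  · refine ⟨1 / r, by positivity, step _ fun k => ?_⟩
    have hb := rpow_one_add_le_one_add_mul_self (s := -(1 / (k + 1 : ℝ)))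
      (by linarith [hle k]) hr.le h
    rw [hid, hk]
    have hp : (0 : ℝ) < (k + 1 : ℝ) ^ r := by positivity
    rw [div_mul_eq_mul_div, le_div_iff₀ hr]
    nlinarith
  · refine ⟨1, one_pos, step _ fun k => ?_⟩
    rw [hid, hk]
    have hp : (0 : ℝ) < (k + 1 : ℝ) ^ r := by positivity
    have h1 : (0 : ℝ) ≤ 1 + -(1 / (k + 1)) := by linarith [hle k]
    have hb : (1 + -(1 / (k + 1 : ℝ))) ^ r ≤ (1 + -(1 / (k + 1 : ℝ))) ^ (1 : ℝ) :=
      Real.rpow_le_rpow_of_exponent_ge' h1 (by simp; positivity) zero_le_one h.le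
    rw [Real.rpow_one] at hb
    nlinarith

theorem add_rpow_le_two_rpow_mul {x y q : ℝ} (hx : 0 ≤ x) (hy : 0 ≤ y) (hq : 0 ≤ q) :
    (x + y) ^ q ≤ 2 ^ q * (x ^ q + y ^ q) := by
  have hm : (x + y) ^ q ≤ (2 * max x y) ^ q := by
    refine Real.rpow_le_rpow (by positivity) ?_ hq
    linarith [le_max_left x y, le_max_right x y]
  refine hm.trans ?_
  rw [Real.mul_rpow zero_le_two (hx.trans (le_max_left x y))]
  refine mul_le_mul_of_nonneg_left ?_ (by positivity)
  have h1 := Real.rpow_nonneg hx q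
  have h2 := Real.rpow_nonneg hy q
  rcases max_choice x y with h | h <;> rw [h] <;> linarith

/-- Hardy's inequality in a pointwise form: the partial sums up to `x` are controlled by
a weighted `ℓ^q`-sum. -/
theorem exists_sum_rpow_le_mul_sum {q : ℝ} (hq : 1 < q) :
    ∃ C : ℝ, 0 < C ∧ ∀ (c : ℕ → ℝ) (S : Finset ℕ) (x : ℝ), 0 ≤ x →
      (∀ k ∈ S, 0 ≤ c k ∧ 1 ≤ k ∧ (k : ℝ) ≤ x) →
      (∑ k ∈ S, c k) ^ q ≤ C * x ^ (1 / 2 : ℝ) * ∑ k ∈ S, c k ^ q * (k : ℝ) ^ (q - 3 / 2) := by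
  have hq1 : 0 < q - 1 := by linarith
  obtain ⟨C, hC, hCM⟩ := exists_sum_rpow_le (r := 1 / (2 * (q - 1))) (by positivity)
  refine ⟨C ^ (q - 1), by positivity, fun c S x hx hS => ?_⟩
  have hconj := Real.HolderConjugate.conjExponent hq
  set q' := q.conjExponent with hq'
  have hq'v : q' = q / (q - 1) := rfl
  -- With this Hölder weight the dual factor is `∑ k^{1/(2(q-1)) - 1} = O(x^{1/(2(q-1))})`, whose
  -- power `q - 1` is exactly `x^{1/2}`.
  set a := (q - 3 / 2) / q with ha
  have hpos : ∀ k ∈ S, (0 : ℝ) < k := fun k hk => by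
    have := (hS k hk).2.1
    positivity
  have hH := Real.inner_le_Lp_mul_Lq_of_nonneg S (f := fun k => c k * (k : ℝ) ^ a)
    (g := fun k => (k : ℝ) ^ (-a)) hconj
    (fun k hk => mul_nonneg (hS k hk).1 (Real.rpow_nonneg (hpos k hk).le _))
    (fun k hk => Real.rpow_nonneg (hpos k hk).le _)
  have e1 : ∑ k ∈ S, c k * (k : ℝ) ^ a * (k : ℝ) ^ (-a) = ∑ k ∈ S, c k := by
    refine sum_congr rfl fun k hk => ?_
    rw [mul_assoc, ← Real.rpow_add (hpos k hk), add_neg_cancel, Real.rpow_zero, mul_one]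
  have e2 : ∑ k ∈ S, (c k * (k : ℝ) ^ a) ^ q = ∑ k ∈ S, c k ^ q * (k : ℝ) ^ (q - 3 / 2) := by
    refine sum_congr rfl fun k hk => ?_
    rw [Real.mul_rpow (hS k hk).1 (Real.rpow_nonneg (hpos k hk).le _),
      ← Real.rpow_mul (hpos k hk).le, ha, div_mul_cancel₀ _ (by linarith)]
  have e3 : ∑ k ∈ S, ((k : ℝ) ^ (-a)) ^ q' = ∑ k ∈ S, (k : ℝ) ^ (1 / (2 * (q - 1)) - 1) := by
    refine sum_congr rfl fun k hk => ?_
    rw [← Real.rpow_mul (hpos k hk).le]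
    congr 1
    rw [ha, hq'v]
    field_simp
    ring
  have e4 : ∑ k ∈ S, (k : ℝ) ^ (1 / (2 * (q - 1)) - 1) ≤ C * x ^ (1 / (2 * (q - 1))) := by
    refine (sum_le_sum_of_subset_of_nonneg (t := Icc 1 ⌊x⌋₊) (fun k hk => ?_)
      (fun k _ _ => by positivity)).trans ((hCM _).trans ?_)
    · rw [mem_Icc]
      exact ⟨(hS k hk).2.1, Nat.le_floor (hS k hk).2.2⟩
    · exact mul_le_mul_of_nonneg_left (Real.rpow_le_rpow (by positivity) (Nat.floor_le hx)
        (by positivity)) hC.le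
  simp only [e1, e2, e3] at hH
  have hA0 : 0 ≤ ∑ k ∈ S, c k ^ q * (k : ℝ) ^ (q - 3 / 2) := sum_nonneg fun k hk =>
    mul_nonneg (Real.rpow_nonneg (hS k hk).1 _) (Real.rpow_nonneg (hpos k hk).le _)
  have hB0 : 0 ≤ ∑ k ∈ S, (k : ℝ) ^ (1 / (2 * (q - 1)) - 1) := sum_nonneg fun k hk => by positivity
  calc (∑ k ∈ S, c k) ^ q ≤ _ := Real.rpow_le_rpow (sum_nonneg fun k hk => (hS k hk).1) hH
        (by linarith)
    _ = (∑ k ∈ S, (k : ℝ) ^ (1 / (2 * (q - 1)) - 1)) ^ (q - 1)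
          * ∑ k ∈ S, c k ^ q * (k : ℝ) ^ (q - 3 / 2) := by
      rw [Real.mul_rpow (by positivity) (by positivity), ← Real.rpow_mul hA0,
        ← Real.rpow_mul hB0, one_div_mul_cancel (by linarith), Real.rpow_one, mul_comm]
      congr 2
      rw [hq'v]; field_simp
    _ ≤ (C * x ^ (1 / (2 * (q - 1)))) ^ (q - 1) * _ :=
      mul_le_mul_of_nonneg_right (Real.rpow_le_rpow hB0 e4 hq1.le) hA0
    _ = _ := by
      rw [Real.mul_rpow hC.le (by positivity), ← Real.rpow_mul hx]
      congr 3
      field_simp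

/-- Up to `m = ⌊π/u⌋` cosines are bounded by one; beyond it Abel's inequality gives `c_m π/u ≤ 2 m
c_m`, and monotonicity gives `m c_m ≤ ∑_{n ≤ k < m} c_k + n c_n`. Keeping the cut-off as a filter on
`k` allows integration in `u` term by term. -/
theorem abs_sum_mul_cos_le_sum_filter {c : ℕ → ℝ} {u : ℝ} (hu : 0 < u) (γ : ℝ) {n : ℕ} (N : ℕ)
    (hc0 : ∀ k, n ≤ k → 0 ≤ c k) (hc : ∀ k, n ≤ k → c (k + 1) ≤ c k) (hn : 1 ≤ n)
    (hnu : n * u ≤ Real.pi) :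
    |∑ k ∈ Ico n N, c k * Real.cos (k * u - γ)|
      ≤ 3 * ∑ k ∈ (Ico n N).filter (fun k : ℕ => (k : ℝ) ≤ Real.pi / u), c k + 2 * (n * c n) := by
  set m := ⌊Real.pi / u⌋₊ with hm
  have hx : 0 ≤ Real.pi / u := (div_pos Real.pi_pos hu).le
  have hnm : n ≤ m := Nat.le_floor (by rwa [le_div_iff₀ hu])
  have hmle : (m : ℝ) ≤ Real.pi / u := Nat.floor_le hx
  have hcn := hc0 n le_rfl
  have htriv : ∀ M, |∑ k ∈ Ico n M, c k * Real.cos (k * u - γ)| ≤ ∑ k ∈ Ico n M, c k := by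
    intro M
    refine (abs_sum_le_sum_abs _ _).trans (sum_le_sum fun k hk => ?_)
    have hk := hc0 k (mem_Ico.mp hk).1
    rw [abs_mul, abs_of_nonneg hk]
    exact mul_le_of_le_one_right hk (Real.abs_cos_le_one _)
  have hsub : ∀ M, M ≤ m → M ≤ N → ∑ k ∈ Ico n M, c k
      ≤ ∑ k ∈ (Ico n N).filter (fun k : ℕ => (k : ℝ) ≤ Real.pi / u), c k := by
    intro M hM hMN
    refine sum_le_sum_of_subset_of_nonneg (fun k hk => ?_) fun k hk _ =>
      hc0 k (mem_Ico.mp (mem_filter.mp hk).1).1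
    rw [mem_Ico] at hk
    rw [mem_filter, mem_Ico]
    refine ⟨⟨hk.1, hk.2.trans_le hMN⟩, le_trans ?_ hmle⟩
    exact_mod_cast (hk.2.trans_le hM).le
  have hF0 : 0 ≤ ∑ k ∈ (Ico n N).filter (fun k : ℕ => (k : ℝ) ≤ Real.pi / u), c k :=
    sum_nonneg fun k hk => hc0 k (mem_Ico.mp (mem_filter.mp hk).1).1
  have hncn : 0 ≤ n * c n := by positivity
  rcases le_or_gt N m with hN | hN
  · linarith [htriv N, hsub N hN le_rfl]
  · have hmm : ∀ m, n ≤ m → (m : ℝ) * c m ≤ ∑ k ∈ Ico n m, c k + n * c n := by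
      intro m hm
      induction m, hm using Nat.le_induction with
      | base => simp
      | succ m hm ih =>
        rw [sum_Ico_succ_top hm]
        push_cast
        nlinarith [hc m hm, (Nat.cast_nonneg m : (0 : ℝ) ≤ m)]
    have hm1 : (1 : ℝ) ≤ m := by exact_mod_cast hn.trans hnm
    have hu' : u ≤ Real.pi := by
      have h1 : (1 : ℝ) ≤ n := by exact_mod_cast hn
      nlinarith
    have htail := abs_sum_mul_cos_le hu hu' γ N (fun k hk => hc0 k (hnm.trans hk))
      (fun k hk => hc k (hnm.trans hk)) (m := m)
    have hlt : Real.pi / u < m + 1 := Nat.lt_floor_add_one _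
    have hcm := hc0 m hnm
    have h2 : c m * (Real.pi / u) ≤ 2 * (m * c m) := by nlinarith
    rw [← sum_Ico_consecutive _ hnm hN.le]
    refine (abs_add_le _ _).trans ?_
    linarith [htriv m, hsub m le_rfl hN.le, hmm m hnm]

theorem integrableOn_indicator_rpow (b : ℝ) :
    IntegrableOn ((Set.Ioc 0 b).indicator fun u : ℝ => u ^ (-(1 / 2) : ℝ)) (Set.Ioc 0 Real.pi) := by
  apply IntegrableOn.indicator _ measurableSet_Ioc
  rw [← intervalIntegrable_iff_integrableOn_Ioc_of_le Real.pi_pos.le]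
  exact intervalIntegral.intervalIntegrable_rpow' (by norm_num)

theorem setIntegral_indicator_rpow {b : ℝ} (hb : 0 ≤ b) (hb' : b ≤ Real.pi) :
    ∫ u in Set.Ioc 0 Real.pi, (Set.Ioc 0 b).indicator (fun u : ℝ => u ^ (-(1 / 2) : ℝ)) u
      = 2 * b ^ (1 / 2 : ℝ) := by
  rw [setIntegral_indicator measurableSet_Ioc, Set.Ioc_inter_Ioc, sup_idem, inf_eq_right.mpr hb',
    ← intervalIntegral.integral_of_le hb, integral_rpow (Or.inl (by norm_num))]
  norm_num
  ring

theorem integrableOn_rpow_neg {a q : ℝ} (ha : 0 < a) :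
    IntegrableOn ((Set.Ioc a Real.pi).indicator fun u : ℝ => u ^ (-q)) (Set.Ioc 0 Real.pi) := by
  rw [integrableOn_indicator_iff measurableSet_Ioc]
  refine IntegrableOn.mono_set ?_ Set.inter_subset_left
  rcases le_or_gt a Real.pi with h | h
  · rw [← intervalIntegrable_iff_integrableOn_Ioc_of_le h]
    refine intervalIntegral.intervalIntegrable_rpow (Or.inr fun h0 => ?_)
    rw [Set.uIcc_of_le h] at h0
    linarith [h0.1]
  · simp [Set.Ioc_eq_empty (not_lt.mpr h.le)]

theorem setIntegral_indicator_rpow_neg_le {a q : ℝ} (ha : 0 < a) (ha' : a ≤ Real.pi)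
    (hq : 1 < q) :
    ∫ u in Set.Ioc 0 Real.pi, (Set.Ioc a Real.pi).indicator (fun u : ℝ => u ^ (-q)) u
      ≤ a ^ (1 - q) / (q - 1) := by
  have hnot : (0 : ℝ) ∉ Set.uIcc a Real.pi := fun h0 => by
    rw [Set.uIcc_of_le ha'] at h0
    linarith [h0.1]
  rw [setIntegral_indicator measurableSet_Ioc, Set.Ioc_inter_Ioc, sup_eq_right.mpr ha.le, inf_idem,
    ← intervalIntegral.integral_of_le ha', integral_rpow (Or.inr ⟨by linarith, hnot⟩)]
  rw [show -q + 1 = -(q - 1) by ring, show 1 - q = -(q - 1) by ring, div_neg, ← neg_div, neg_sub]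
  refine div_le_div_of_nonneg_right ?_ (by linarith)
  linarith [Real.rpow_nonneg Real.pi_pos.le (-(q - 1))]

/-- The upper half of the Hardy–Littlewood theorem for series with monotone coefficients, on a
half-period. -/
theorem exists_setIntegral_abs_sum_cos_rpow_le {q : ℝ} (hq : 1 < q) :
    ∃ C : ℝ, 0 < C ∧ ∀ (c : ℕ → ℝ) (n N : ℕ) (γ : ℝ), 1 ≤ n → (∀ k, n ≤ k → 0 ≤ c k) →
      (∀ k, n ≤ k → c (k + 1) ≤ c k) →
      ∫ u in Set.Ioc 0 Real.pi, |∑ k ∈ Ico n N, c k * Real.cos (k * u - γ)| ^ q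
        ≤ C * (c n ^ q * (n : ℝ) ^ (q - 1)
          + ∑ k ∈ Ico n N, c k ^ q * (k : ℝ) ^ (q - 2)) := by
  obtain ⟨C₀, hC₀, hH⟩ := exists_sum_rpow_le_mul_sum hq
  have hq0 : 0 ≤ q := by linarith
  have hq1 : 0 < q - 1 := by linarith
  have hπ := Real.pi_pos
  set A : ℝ := 2 ^ q * 3 ^ q * C₀ * Real.pi ^ (1 / 2 : ℝ) with hA
  set B : ℝ := 2 ^ q * 2 ^ q with hB
  have hA0 : 0 < A := by positivity
  have hB0 : 0 < B := by positivity
  refine ⟨A * (2 * Real.pi ^ (1 / 2 : ℝ)) + B * Real.pi + Real.pi / (q - 1), by positivity,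
    fun c n N γ hn hc0 hc => ?_⟩
  have hn0 : (0 : ℝ) < n := by positivity
  have hcn := hc0 n le_rfl
  have hcnq : 0 ≤ c n ^ q := Real.rpow_nonneg hcn q
  set b : ℝ := Real.pi / n with hb
  have hb0 : 0 < b := div_pos hπ hn0
  have hbπ : b ≤ Real.pi := div_le_self hπ.le (by exact_mod_cast hn)
  have hkpos : ∀ k ∈ Ico n N, (0 : ℝ) < k := fun k hk => by
    exact_mod_cast (hn.trans (mem_Ico.mp hk).1)
  -- `G + G₁` majorizes the integrand on `(0, π/n]`: `G` carries the Hardy bound of the filtered sum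
  -- and `G₁` the term `n c_n`. On `(π/n, π]` the majorant is `G₂`, from Abel's inequality.
  set G : ℝ → ℝ := fun u => A * ∑ k ∈ Ico n N, c k ^ q * (k : ℝ) ^ (q - 3 / 2) *
      (Set.Ioc 0 (Real.pi / k)).indicator (fun u : ℝ => u ^ (-(1 / 2) : ℝ)) u with hG
  set G₁ : ℝ → ℝ := (Set.Ioc 0 b).indicator (fun _ => B * (c n ^ q * (n : ℝ) ^ q)) with hG₁
  set G₂ : ℝ → ℝ := fun u => c n ^ q * Real.pi ^ q *
    (Set.Ioc b Real.pi).indicator (fun u : ℝ => u ^ (-q)) u with hG₂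
  have hGi : IntegrableOn G (Set.Ioc 0 Real.pi) :=
    (integrable_finsetSum _ fun k hk =>
      (integrableOn_indicator_rpow (Real.pi / (k : ℕ))).const_mul _).const_mul _
  have hG₁i : IntegrableOn G₁ (Set.Ioc 0 Real.pi) :=
    IntegrableOn.indicator (integrableOn_const (by simp)) measurableSet_Ioc
  have hG₂i : IntegrableOn G₂ (Set.Ioc 0 Real.pi) := (integrableOn_rpow_neg hb0).const_mul _
  have hG0 : ∀ u, 0 ≤ G u := fun u => mul_nonneg hA0.le <| sum_nonneg fun k hk =>
    mul_nonneg (mul_nonneg (Real.rpow_nonneg (hc0 k (mem_Ico.mp hk).1) _) (by positivity))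
      (Set.indicator_nonneg (fun u hu => Real.rpow_nonneg hu.1.le _) u)
  have hpt : ∀ u ∈ Set.Ioc 0 Real.pi,
      |∑ k ∈ Ico n N, c k * Real.cos (k * u - γ)| ^ q ≤ G u + (G₁ u + G₂ u) := by
    intro u ⟨hu0, huπ⟩
    rcases le_or_gt u b with hub | hub
    · have hG₁u : G₁ u = B * (c n ^ q * (n : ℝ) ^ q) := Set.indicator_of_mem (Set.mem_Ioc.mpr ⟨hu0, hub⟩) _
      have hG₂u : G₂ u = 0 := by
        simp only [hG₂]
        rw [Set.indicator_of_notMem (fun h => absurd h.1 (not_lt.mpr hub)), mul_zero]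
      have hnu : n * u ≤ Real.pi := by
        rw [hb, le_div_iff₀ hn0] at hub; linarith
      set S := (Ico n N).filter (fun k : ℕ => (k : ℝ) ≤ Real.pi / u) with hS
      have hS0 : 0 ≤ ∑ k ∈ S, c k :=
        sum_nonneg fun k hk => hc0 k (mem_Ico.mp (mem_filter.mp hk).1).1
      have h1 := Real.rpow_le_rpow (abs_nonneg _)
        (abs_sum_mul_cos_le_sum_filter hu0 γ N hc0 hc hn hnu) hq0
      have h2 := add_rpow_le_two_rpow_mul (x := 3 * ∑ k ∈ S, c k) (y := 2 * (n * c n))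
        (by positivity) (by positivity) hq0
      have h3 := hH c S (Real.pi / u) (div_pos hπ hu0).le fun k hk =>
        ⟨hc0 k (mem_Ico.mp (mem_filter.mp hk).1).1,
          hn.trans (mem_Ico.mp (mem_filter.mp hk).1).1, (mem_filter.mp hk).2⟩
      have h4 : G u = A * (u ^ (-(1 / 2) : ℝ) * ∑ k ∈ S, c k ^ q * (k : ℝ) ^ (q - 3 / 2)) := by
        simp only [hG, hS]
        congr 1
        rw [sum_filter, mul_sum]
        refine sum_congr rfl fun k hk => ?_
        have hiff : u ∈ Set.Ioc 0 (Real.pi / k) ↔ (k : ℝ) ≤ Real.pi / u := by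
          rw [Set.mem_Ioc, le_div_iff₀ (hkpos k hk), le_div_iff₀ hu0, mul_comm]
          exact and_iff_right hu0
        by_cases h : (k : ℝ) ≤ Real.pi / u
        · rw [if_pos h, Set.indicator_of_mem (hiff.mpr h), mul_comm]
        · rw [if_neg h, Set.indicator_of_notMem (mt hiff.mp h)]; simp
      rw [Real.mul_rpow (by norm_num) hS0, Real.mul_rpow (by norm_num) (by positivity),
        Real.mul_rpow hn0.le hcn] at h2
      rw [Real.div_rpow hπ.le hu0.le, div_eq_mul_inv, ← Real.rpow_neg hu0.le] at h3
      rw [hG₁u, hG₂u, h4]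
      refine h1.trans (h2.trans ?_)
      have h5 := mul_le_mul_of_nonneg_left h3 (by positivity : (0 : ℝ) ≤ 2 ^ q * 3 ^ q)
      rw [hA, hB]
      linarith
    · have hG₁u : G₁ u = 0 := Set.indicator_of_notMem (fun h => absurd h.2 (not_le.mpr hub)) _
      have hG₂u : G₂ u = c n ^ q * Real.pi ^ q * u ^ (-q) := by
        simp only [hG₂]
        rw [Set.indicator_of_mem (Set.mem_Ioc.mpr ⟨hub, huπ⟩)]
      have h1 := Real.rpow_le_rpow (abs_nonneg _) (abs_sum_mul_cos_le hu0 huπ γ N hc0 hc) hq0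
      rw [Real.mul_rpow hcn (div_pos hπ hu0).le, Real.div_rpow hπ.le hu0.le, div_eq_mul_inv,
        ← Real.rpow_neg hu0.le, ← mul_assoc] at h1
      rw [hG₁u, hG₂u]
      linarith [hG0 u]
  have hmono : ∫ u in Set.Ioc 0 Real.pi, |∑ k ∈ Ico n N, c k * Real.cos (k * u - γ)| ^ q
      ≤ ∫ u in Set.Ioc 0 Real.pi, G u + (G₁ u + G₂ u) := by
    refine setIntegral_mono_on ?_ (hGi.add (hG₁i.add hG₂i)) measurableSet_Ioc hpt
    refine Continuous.integrableOn_Ioc ?_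
    exact Continuous.rpow_const (by fun_prop) fun _ => Or.inr hq0
  have hT0 : 0 ≤ c n ^ q * (n : ℝ) ^ (q - 1) := by positivity
  have hS0 : 0 ≤ ∑ k ∈ Ico n N, c k ^ q * (k : ℝ) ^ (q - 2) := sum_nonneg fun k hk =>
    mul_nonneg (Real.rpow_nonneg (hc0 k (mem_Ico.mp hk).1) _) (by positivity)
  -- The integral of `u^{-1/2}` over `(0, π/k]` is `2(π/k)^{1/2}`, which lowers the exponent `q -
  -- 3/2` to `q - 2`.
  have hIG : ∫ u in Set.Ioc 0 Real.pi, G u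
      = A * (2 * Real.pi ^ (1 / 2 : ℝ)) * ∑ k ∈ Ico n N, c k ^ q * (k : ℝ) ^ (q - 2) := by
    simp only [hG]
    rw [integral_const_mul, integral_finsetSum _ fun k hk =>
      (integrableOn_indicator_rpow (Real.pi / (k : ℕ))).const_mul _, mul_assoc A]
    congr 1
    rw [mul_sum]
    refine sum_congr rfl fun k hk => ?_
    have hk0 := hkpos k hk
    rw [integral_const_mul, setIntegral_indicator_rpow (div_pos hπ hk0).le
      (div_le_self hπ.le (by exact_mod_cast hn.trans (mem_Ico.mp hk).1)),
      Real.div_rpow hπ.le hk0.le, show q - 3 / 2 = (q - 2) + 1 / 2 by ring, Real.rpow_add hk0]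
    field_simp
  have hIG₁ : ∫ u in Set.Ioc 0 Real.pi, G₁ u = B * Real.pi * (c n ^ q * (n : ℝ) ^ (q - 1)) := by
    simp only [hG₁]
    rw [setIntegral_indicator measurableSet_Ioc, Set.Ioc_inter_Ioc, sup_idem,
      inf_eq_right.mpr hbπ, setIntegral_const, Real.volume_real_Ioc_of_le hb0.le, sub_zero,
      smul_eq_mul, hb, Real.rpow_sub_one hn0.ne']
    ring
  have hIG₂ : ∫ u in Set.Ioc 0 Real.pi, G₂ u
      ≤ Real.pi / (q - 1) * (c n ^ q * (n : ℝ) ^ (q - 1)) := by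
    simp only [hG₂]
    rw [integral_const_mul]
    refine (mul_le_mul_of_nonneg_left (setIntegral_indicator_rpow_neg_le hb0 hbπ hq)
      (by positivity)).trans_eq ?_
    have e : b ^ (1 - q) = Real.pi ^ (1 - q) * (n : ℝ) ^ (q - 1) := by
      rw [hb, Real.div_rpow hπ.le hn0.le, show 1 - q = -(q - 1) by ring,
        Real.rpow_neg hn0.le, div_inv_eq_mul]
    have e' : Real.pi ^ q * Real.pi ^ (1 - q) = Real.pi := by
      rw [← Real.rpow_add hπ, add_sub_cancel, Real.rpow_one]
    rw [e]
    linear_combination (c n ^ q * (n : ℝ) ^ (q - 1) / (q - 1)) * e'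
  rw [integral_add (f := G) (g := fun u => G₁ u + G₂ u) hGi (hG₁i.add hG₂i),
    integral_add hG₁i hG₂i, hIG, hIG₁] at hmono
  have k1 : 0 ≤ A * (2 * Real.pi ^ (1 / 2 : ℝ)) * (c n ^ q * (n : ℝ) ^ (q - 1)) := by positivity
  have k2 : 0 ≤ (B * Real.pi + Real.pi / (q - 1))
      * ∑ k ∈ Ico n N, c k ^ q * (k : ℝ) ^ (q - 2) := by positivity
  linarith

/-- The upper half of the Hardy–Littlewood theorem for series with monotone coefficients. -/
theorem exists_integral_abs_sum_cos_rpow_le {q : ℝ} (hq : 1 < q) :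
    ∃ C : ℝ, 0 < C ∧ ∀ (c : ℕ → ℝ) (n N : ℕ) (γ : ℝ), 1 ≤ n → (∀ k, n ≤ k → 0 ≤ c k) →
      (∀ k, n ≤ k → c (k + 1) ≤ c k) →
      ∫ u in (0 : ℝ)..(2 * Real.pi), |∑ k ∈ Ico n N, c k * Real.cos (k * u - γ)| ^ q
        ≤ C * (c n ^ q * (n : ℝ) ^ (q - 1)
          + ∑ k ∈ Ico n N, c k ^ q * (k : ℝ) ^ (q - 2)) := by
  obtain ⟨C, hC, h⟩ := exists_setIntegral_abs_sum_cos_rpow_le hq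
  refine ⟨2 * C, by positivity, fun c n N γ hn hc0 hc => ?_⟩
  have hcont : ∀ γ, Continuous fun u : ℝ => |∑ k ∈ Ico n N, c k * Real.cos (k * u - γ)| ^ q :=
    fun γ => Continuous.rpow_const (by fun_prop) fun _ => Or.inr (by linarith)
  have h1 := h c n N γ hn hc0 hc
  have h2 := h c n N (-γ) hn hc0 hc
  rw [← intervalIntegral.integral_of_le Real.pi_pos.le] at h1 h2
  -- The reflection `u ↦ 2π - u` maps the second half-period to the first and changes `γ` to `-γ`.
  have h3 : ∫ u in Real.pi..(2 * Real.pi), |∑ k ∈ Ico n N, c k * Real.cos (k * u - γ)| ^ q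
      = ∫ u in (0 : ℝ)..Real.pi, |∑ k ∈ Ico n N, c k * Real.cos (k * u - -γ)| ^ q := by
    have := intervalIntegral.integral_comp_sub_left (a := 0) (b := Real.pi)
      (fun u => |∑ k ∈ Ico n N, c k * Real.cos (k * u - γ)| ^ q) (2 * Real.pi)
    rw [show 2 * Real.pi - Real.pi = Real.pi by ring, sub_zero] at this
    rw [← this]
    refine intervalIntegral.integral_congr fun u _ => ?_
    refine congrArg (fun x : ℝ => |x| ^ q) (sum_congr rfl fun k _ => ?_)
    rw [show (k : ℝ) * (2 * Real.pi - u) - γ = k * (2 * Real.pi) - (k * u - -γ) by ring,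
      Real.cos_nat_mul_two_pi_sub]
  rw [← intervalIntegral.integral_add_adjacent_intervals
    ((hcont γ).intervalIntegrable 0 Real.pi) ((hcont γ).intervalIntegrable _ _), h3]
  linarith

/-! ### Convolution representation and duality -/

/-- The `k`-th harmonic of the convolution of `φ` with a kernel of phase `γ`. -/
noncomputable def convHarmonic (φ : ℝ → ℝ) (γ x : ℝ) (k : ℕ) : ℝ :=
  ∫ t in (0 : ℝ)..(2 * Real.pi), φ t * Real.cos (k * (x - t) - γ)

theorem PeriodicLp.intervalIntegrable {φ : ℝ → ℝ} (h : PeriodicLp 1 φ) :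
    IntervalIntegrable φ volume 0 (2 * Real.pi) := by
  rw [intervalIntegrable_iff_integrableOn_Ioc_of_le Real.two_pi_pos.le]
  have := h.2
  rw [ENNReal.ofReal_one] at this
  exact memLp_one_iff_integrable.mp this

/-- The defining identity is evaluated at `y/k` with `y = kx - βπ/2`, which transfers the phase from
`f` to `φ`; the harmonic of `φ` at that point is then a convolution integral. -/
theorem IsPsiBetaDerivative.harmonic_eq {ψ : ℝ → ℝ} {β : ℝ} {f φ : ℝ → ℝ}
    (h : IsPsiBetaDerivative ψ β f φ) {k : ℕ} (hk : 1 ≤ k) (hψ : 0 < ψ k) (x : ℝ) :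
    fourierCos f k * Real.cos (k * x) + fourierSin f k * Real.sin (k * x)
      = ψ k / Real.pi * convHarmonic φ (β * Real.pi / 2) x k := by
  have hk0 : (k : ℝ) ≠ 0 := by positivity
  set y : ℝ := k * x - β * Real.pi / 2 with hy
  have h1 := h.2.2 k hk (y / k)
  have e1 : (k : ℝ) * (y / k) = y := by field_simp
  have e2 : y + β * Real.pi / 2 = k * x := by rw [hy]; ring
  rw [e1, e2] at h1
  have hi := h.1.intervalIntegrable
  have hic : ∀ g : ℝ → ℝ, Continuous g →
      IntervalIntegrable (fun t => φ t * g t) volume 0 (2 * Real.pi) :=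
    fun g hg => hi.mul_continuousOn hg.continuousOn
  have h2 : fourierCos φ k * Real.cos y + fourierSin φ k * Real.sin y
      = 1 / Real.pi * convHarmonic φ (β * Real.pi / 2) x k := by
    unfold fourierCos fourierSin convHarmonic
    rw [mul_assoc, mul_assoc, ← mul_add, ← intervalIntegral.integral_mul_const,
      ← intervalIntegral.integral_mul_const, ← intervalIntegral.integral_add
        ((hic _ (by fun_prop)).mul_const _) ((hic _ (by fun_prop)).mul_const _)]
    congr 1
    refine intervalIntegral.integral_congr fun t _ => ?_
    have : (k : ℝ) * (x - t) - β * Real.pi / 2 = y - k * t := by rw [hy]; ring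
    simp only [this, Real.cos_sub]
    ring
  rw [h2] at h1
  field_simp at h1 ⊢
  linarith

theorem sum_mul_convHarmonic {φ : ℝ → ℝ} (hφ : PeriodicLp 1 φ) (c : ℕ → ℝ) (S : Finset ℕ)
    (γ x : ℝ) :
    ∑ k ∈ S, c k * convHarmonic φ γ x k
      = ∫ t in (0 : ℝ)..(2 * Real.pi), φ t * ∑ k ∈ S, c k * Real.cos (k * (x - t) - γ) := by
  simp only [mul_sum]
  rw [intervalIntegral.integral_finsetSum fun k _ =>
    hφ.intervalIntegrable.mul_continuousOn (Continuous.continuousOn (by fun_prop))]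
  refine sum_congr rfl fun k _ => ?_
  unfold convHarmonic
  rw [← intervalIntegral.integral_const_mul]
  exact intervalIntegral.integral_congr fun t _ => by ring

theorem integral_comp_sub_left_of_periodic {Q : ℝ → ℝ} (hQ : Function.Periodic Q (2 * Real.pi))
    (x : ℝ) :
    ∫ t in (0 : ℝ)..(2 * Real.pi), Q (x - t) = ∫ t in (0 : ℝ)..(2 * Real.pi), Q t := by
  rw [intervalIntegral.integral_comp_sub_left, sub_zero]
  have := hQ.intervalIntegral_add_eq (x - 2 * Real.pi) 0
  simpa using this

theorem sum_mul_cos_periodic (c : ℕ → ℝ) (S : Finset ℕ) (γ : ℝ) :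
    Function.Periodic (fun u : ℝ => ∑ k ∈ S, c k * Real.cos (k * u - γ)) (2 * Real.pi) := by
  intro u
  refine sum_congr rfl fun k _ => ?_
  rw [show (k : ℝ) * (u + 2 * Real.pi) - γ = k * u - γ + k * (2 * Real.pi) by ring,
    Real.cos_add_nat_mul_two_pi]

theorem continuous_sum_mul_cos (c : ℕ → ℝ) (S : Finset ℕ) (γ : ℝ) :
    Continuous fun u : ℝ => ∑ k ∈ S, c k * Real.cos (k * u - γ) := by fun_prop

theorem integral_norm_rpow_le_one {p : ℝ} (hp : 0 < p) {φ : ℝ → ℝ} (hφ : φ ∈ unitBall p) :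
    (∫ t in Set.Ioc 0 (2 * Real.pi), ‖φ t‖ ^ p) ^ (1 / p) ≤ 1 := by
  have h := hφ.2
  unfold periodNorm at h
  rw [MemLp.eLpNorm_eq_integral_rpow_norm (by simpa using hp) ENNReal.ofReal_ne_top hφ.1.2,
    ENNReal.toReal_ofReal hp.le, ENNReal.ofReal_le_one] at h
  rwa [one_div]

theorem Continuous.memLp_period {Q : ℝ → ℝ} (hQ : Continuous Q) (r : ℝ≥0∞) :
    MemLp Q r (volume.restrict (Set.Ioc 0 (2 * Real.pi))) := by
  obtain ⟨C, hC⟩ := (isCompact_Icc (a := (0 : ℝ)) (b := 2 * Real.pi)).exists_bound_of_continuousOn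
    hQ.continuousOn
  refine MemLp.of_bound hQ.aestronglyMeasurable C ?_
  exact (ae_restrict_iff' measurableSet_Ioc).mpr
    (Filter.Eventually.of_forall fun t ht => hC t (Set.Ioc_subset_Icc_self ht))

theorem abs_integral_mul_le_of_unitBall {p q : ℝ} (hpq : p.HolderConjugate q) {φ Q : ℝ → ℝ}
    (hφ : φ ∈ unitBall p) (hQ : Continuous Q) (hQp : Function.Periodic Q (2 * Real.pi)) (x : ℝ) :
    |∫ t in (0 : ℝ)..(2 * Real.pi), φ t * Q (x - t)|
      ≤ (∫ t in (0 : ℝ)..(2 * Real.pi), |Q t| ^ q) ^ (1 / q) := by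
  have hQx : Continuous fun t => Q (x - t) := by fun_prop
  have h1 := integral_mul_norm_le_Lp_mul_Lq hpq hφ.1.2 (Continuous.memLp_period hQx _)
  have h2 : ∫ t in Set.Ioc 0 (2 * Real.pi), ‖Q (x - t)‖ ^ q
      = ∫ t in (0 : ℝ)..(2 * Real.pi), |Q t| ^ q := by
    rw [← intervalIntegral.integral_of_le Real.two_pi_pos.le]
    exact integral_comp_sub_left_of_periodic (Q := fun t => |Q t| ^ q)
      (fun t => by simp only [hQp t]) x
  rw [h2] at h1
  rw [intervalIntegral.integral_of_le Real.two_pi_pos.le, ← Real.norm_eq_abs]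
  refine (norm_integral_le_integral_norm _).trans ?_
  simp only [norm_mul]
  refine h1.trans (mul_le_of_le_one_left (Real.rpow_nonneg ?_ _)
    (integral_norm_rpow_le_one hpq.pos hφ))
  exact intervalIntegral.integral_nonneg Real.two_pi_pos.le fun t _ =>
    Real.rpow_nonneg (abs_nonneg _) _

theorem abs_integral_mul_le_of_unitBall_one {φ Q : ℝ → ℝ} (hφ : φ ∈ unitBall 1)
    {B : ℝ} (hB : ∀ t, |Q t| ≤ B) (x : ℝ) :
    |∫ t in (0 : ℝ)..(2 * Real.pi), φ t * Q (x - t)| ≤ B := by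
  have hB0 : 0 ≤ B := (abs_nonneg _).trans (hB 0)
  have h1 := integral_norm_rpow_le_one one_pos hφ
  simp only [Real.rpow_one, div_one] at h1
  have hi : IntegrableOn φ (Set.Ioc 0 (2 * Real.pi)) := by
    have := hφ.1.2
    rw [ENNReal.ofReal_one] at this
    exact memLp_one_iff_integrable.mp this
  rw [intervalIntegral.integral_of_le Real.two_pi_pos.le, ← Real.norm_eq_abs]
  calc _ ≤ ∫ t in Set.Ioc 0 (2 * Real.pi), ‖φ t‖ * B := by
        refine norm_integral_le_of_norm_le (hi.norm.mul_const B)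
          (Filter.Eventually.of_forall fun t => ?_)
        rw [norm_mul]
        exact mul_le_mul_of_nonneg_left (hB _) (norm_nonneg _)
    _ = (∫ t in Set.Ioc 0 (2 * Real.pi), ‖φ t‖) * B := integral_mul_const _ _
    _ ≤ B := mul_le_of_le_one_left hB0 h1

/-- Hölder against the unit ball of `L_p` leaves the `L_q` norm of the kernel, which is translation
invariant and falls under Hardy–Littlewood. -/
theorem exists_abs_sum_mul_convHarmonic_le {p q : ℝ} (hpq : p.HolderConjugate q) :
    ∃ C : ℝ, 0 < C ∧ ∀ φ ∈ unitBall p, PeriodicLp 1 φ → ∀ (c : ℕ → ℝ) (n N : ℕ) (γ x : ℝ),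
      1 ≤ n → (∀ k, n ≤ k → 0 ≤ c k) → (∀ k, n ≤ k → c (k + 1) ≤ c k) →
      |∑ k ∈ Ico n N, c k * convHarmonic φ γ x k|
        ≤ C * (c n ^ q * (n : ℝ) ^ (q - 1)
          + ∑ k ∈ Ico n N, c k ^ q * (k : ℝ) ^ (q - 2)) ^ (1 / q) := by
  obtain ⟨C, hC, h⟩ := exists_integral_abs_sum_cos_rpow_le hpq.symm.lt
  refine ⟨C ^ (1 / q), by positivity, fun φ hφ hφ1 c n N γ x hn hc0 hc => ?_⟩
  rw [sum_mul_convHarmonic hφ1]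
  refine (abs_integral_mul_le_of_unitBall hpq hφ (continuous_sum_mul_cos c (Ico n N) γ)
    (sum_mul_cos_periodic c (Ico n N) γ) x).trans ?_
  rw [← Real.mul_rpow hC.le]
  · refine Real.rpow_le_rpow ?_ (h c n N γ hn hc0 hc) (one_div_nonneg.mpr hpq.symm.nonneg)
    exact intervalIntegral.integral_nonneg Real.two_pi_pos.le fun t _ =>
      Real.rpow_nonneg (abs_nonneg _) _
  · exact add_nonneg (mul_nonneg (Real.rpow_nonneg (hc0 n le_rfl) _) (by positivity))
      (sum_nonneg fun k hk => mul_nonneg (Real.rpow_nonneg (hc0 k (mem_Ico.mp hk).1) _)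
        (by positivity))

/-- Taking all coefficients equal to one bounds the `L_q` norm of a phase-shifted Dirichlet kernel;
the exponent is `(q - 1)/q = 1/p`. -/
theorem exists_abs_sum_convHarmonic_le {p q : ℝ} (hpq : p.HolderConjugate q) :
    ∃ C : ℝ, 0 < C ∧ ∀ φ ∈ unitBall p, PeriodicLp 1 φ → ∀ (m : ℕ) (γ x : ℝ),
      |∑ k ∈ Icc 1 m, convHarmonic φ γ x k| ≤ C * (m : ℝ) ^ (1 / p) := by
  obtain ⟨C, hC, h⟩ := exists_abs_sum_mul_convHarmonic_le hpq
  have hq1 : 0 < q - 1 := by linarith [hpq.symm.lt]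
  obtain ⟨D, hD, hDM⟩ := exists_sum_rpow_le hq1
  refine ⟨C * (1 + D) ^ (1 / q), by positivity, fun φ hφ hφ1 m γ x => ?_⟩
  rcases Nat.eq_zero_or_pos m with rfl | hm
  · simp only [zero_lt_one, Icc_eq_empty_of_lt, sum_empty, abs_zero]
    positivity
  have h1 := h φ hφ hφ1 (fun _ => 1) 1 (m + 1) γ x le_rfl (fun _ _ => zero_le_one)
    (fun _ _ => le_rfl)
  simp only [one_mul, Real.one_rpow, Nat.cast_one] at h1
  rw [show Ico 1 (m + 1) = Icc 1 m from rfl] at h1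
  have hm1 : (1 : ℝ) ≤ m := by exact_mod_cast hm
  have h2 := hDM m
  rw [show q - 1 - 1 = q - 2 by ring] at h2
  have h3 : 1 ≤ (m : ℝ) ^ (q - 1) := Real.one_le_rpow hm1 hq1.le
  have h4 : ((m : ℝ) ^ (q - 1)) ^ (1 / q) = (m : ℝ) ^ (1 / p) := by
    rw [← Real.rpow_mul (by positivity)]
    congr 1
    have := hpq.inv_add_inv_eq_one
    have hq0 := hpq.symm.ne_zero
    rw [one_div, one_div, sub_mul, mul_inv_cancel₀ hq0]
    linarith
  rw [mul_assoc, ← h4, ← Real.mul_rpow (by positivity) (by positivity)]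
  refine h1.trans (mul_le_mul_of_nonneg_left (Real.rpow_le_rpow ?_ ?_
    (one_div_nonneg.mpr hpq.symm.nonneg)) hC.le)
  · exact add_nonneg zero_le_one (sum_nonneg fun k _ => by positivity)
  · linarith

/-! ### Low frequencies and sine sums -/

/-- Abel summation for the low frequencies of the Fejér deviation. -/
theorem abs_sum_nat_mul_le {u e : ℕ → ℝ} {B s : ℝ} (hs0 : 0 ≤ s) (hs1 : s ≤ 1)
    (hu0 : ∀ k, 1 ≤ k → 0 ≤ u k)
    (hg : ∀ k : ℕ, 1 ≤ k → u (k + 1) * ((k + 1 : ℕ) : ℝ) ^ s ≤ u k * (k : ℝ) ^ s)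
    (he : ∀ m : ℕ, |∑ k ∈ Icc 1 m, e k| ≤ B * (m : ℝ) ^ s) {n : ℕ} (hn : 1 ≤ n) :
    |∑ k ∈ Ico 1 n, (k * u k) * e k| ≤ 3 * B * ∑ k ∈ Icc 1 n, u k * (k : ℝ) ^ s := by
  have hB : 0 ≤ B := by
    have := (abs_nonneg _).trans (he 1)
    simpa using this
  have key : ∀ n, 1 ≤ n → ∑ k ∈ Ico 1 n, (k * u k) * e k
      = ∑ k ∈ Ico 1 n, (k * u k - ((k + 1 : ℕ) : ℝ) * u (k + 1)) * (∑ j ∈ Icc 1 k, e j)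
        + n * u n * ∑ j ∈ Ico 1 n, e j := by
    intro n hn
    induction n, hn using Nat.le_induction with
    | base => simp
    | succ n hn ih =>
      have : ∑ j ∈ Icc 1 n, e j = ∑ j ∈ Ico 1 n, e j + e n := sum_Ico_succ_top hn e
      rw [sum_Ico_succ_top hn, ih, sum_Ico_succ_top hn, sum_Ico_succ_top hn, this]
      ring
  -- With `g_k = u_k k^s`, the terms `k(g_k - g_{k+1})` and `n g_n` resum to `∑ g_k`, and the
  -- remaining ones contribute at most twice that sum.
  have tele : ∀ n : ℕ, 1 ≤ n →
      ∑ k ∈ Ico 1 n, (k * (u k * (k : ℝ) ^ s - u (k + 1) * ((k + 1 : ℕ) : ℝ) ^ s)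
        + 2 * (u (k + 1) * ((k + 1 : ℕ) : ℝ) ^ s)) + n * (u n * (n : ℝ) ^ s)
      ≤ 3 * ∑ k ∈ Icc 1 n, u k * (k : ℝ) ^ s := by
    intro n hn
    induction n, hn using Nat.le_induction with
    | base =>
      have := hu0 1 le_rfl
      simp; linarith
    | succ n hn ih =>
      rw [sum_Ico_succ_top hn, sum_Icc_succ_top (by lia)]
      have : 0 ≤ u (n + 1) * ((n + 1 : ℕ) : ℝ) ^ s :=
        mul_nonneg (hu0 _ (by lia)) (by positivity)
      have hc : ((n + 1 : ℕ) : ℝ) = n + 1 := by push_cast; ring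
      rw [hc] at this ⊢
      linarith
  -- The sequence `k u_k` need not be monotone; both signs of its increment are controlled through
  -- the monotone `g_k = u_k k^s`.
  have hterm : ∀ k : ℕ, 1 ≤ k → |k * u k - ((k + 1 : ℕ) : ℝ) * u (k + 1)| * (k : ℝ) ^ s
      ≤ k * (u k * (k : ℝ) ^ s - u (k + 1) * ((k + 1 : ℕ) : ℝ) ^ s)
        + 2 * (u (k + 1) * ((k + 1 : ℕ) : ℝ) ^ s) := by
    intro k hk
    have hk0 : (0 : ℝ) < k := by exact_mod_cast hk
    have hu1 := hu0 (k + 1) (by lia)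
    have hc : ((k + 1 : ℕ) : ℝ) = k + 1 := by push_cast; ring
    have hgk := hg k hk
    rw [hc] at hgk ⊢
    have hX : 0 < (k : ℝ) ^ s := by positivity
    have hXY : (k : ℝ) ^ s ≤ (k + 1 : ℝ) ^ s := Real.rpow_le_rpow hk0.le (by linarith) hs0
    -- Here `s ≤ 1` enters: `(1 + 1/k)^s ≤ 1 + 1/k`.
    have hYX : (k : ℝ) * (k + 1 : ℝ) ^ s ≤ (k + 1) * (k : ℝ) ^ s := by
      have hb := rpow_one_add_le_one_add_mul_self (s := 1 / (k : ℝ))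
        (by linarith [one_div_pos.mpr hk0]) hs0 hs1
      have e : (k + 1 : ℝ) ^ s = (k : ℝ) ^ s * (1 + 1 / k) ^ s := by
        rw [← Real.mul_rpow hk0.le (by positivity)]
        congr 1; field_simp
      have hb' : (1 + 1 / (k : ℝ)) ^ s ≤ 1 + 1 / k := by
        refine hb.trans ?_
        have := one_div_pos.mpr hk0
        nlinarith
      rw [e]
      calc (k : ℝ) * ((k : ℝ) ^ s * (1 + 1 / k) ^ s) ≤ k * ((k : ℝ) ^ s * (1 + 1 / k)) := by gcongr
        _ = _ := by field_simp
    set X := (k : ℝ) ^ s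
    set Y := (k + 1 : ℝ) ^ s
    have huX : u (k + 1) * X ≤ u (k + 1) * Y := mul_le_mul_of_nonneg_left hXY hu1
    have huk : u (k + 1) * (k * Y) ≤ u (k + 1) * ((k + 1) * X) :=
      mul_le_mul_of_nonneg_left hYX hu1
    have huk' : k * (u (k + 1) * X) ≤ k * (u (k + 1) * Y) :=
      mul_le_mul_of_nonneg_left huX hk0.le
    have hgk' := mul_le_mul_of_nonneg_left hgk hk0.le
    rw [← abs_of_pos hX, ← abs_mul, abs_of_pos hX, abs_le]
    constructor <;> nlinarith
  have heI : ∀ n : ℕ, 1 ≤ n → |∑ j ∈ Ico 1 n, e j| ≤ B * (n : ℝ) ^ s := by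
    intro n hn
    obtain ⟨m, rfl⟩ := Nat.exists_eq_add_of_le' hn
    refine (he m).trans (mul_le_mul_of_nonneg_left (Real.rpow_le_rpow (by positivity) ?_ hs0) hB)
    push_cast; linarith
  rw [key n hn]
  calc _ ≤ ∑ k ∈ Ico 1 n, B * (|k * u k - ((k + 1 : ℕ) : ℝ) * u (k + 1)| * (k : ℝ) ^ s)
        + B * (n * (u n * (n : ℝ) ^ s)) := by
        refine (abs_add_le _ _).trans (add_le_add ((abs_sum_le_sum_abs _ _).trans
          (sum_le_sum fun k hk => ?_)) ?_)
        · rw [abs_mul, mul_left_comm]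
          exact mul_le_mul_of_nonneg_left (he k) (abs_nonneg _)
        · have hn0 : 0 ≤ n * u n := mul_nonneg (by positivity) (hu0 n hn)
          rw [abs_mul, abs_of_nonneg hn0]
          exact (mul_le_mul_of_nonneg_left (heI n hn) hn0).trans_eq (by ring)
    _ ≤ B * (3 * ∑ k ∈ Icc 1 n, u k * (k : ℝ) ^ s) := by
        rw [← mul_sum, ← mul_add]
        refine mul_le_mul_of_nonneg_left (le_trans ?_ (tele n hn)) hB
        gcongr with k hk
        exact hterm k (mem_Ico.mp hk).1
    _ = _ := by ring

/-- Sums of sines with coefficients `c k` such that `k * c k` is non-increasing. -/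
theorem abs_sum_mul_sin_le {c : ℕ → ℝ} {n : ℕ} (N : ℕ) (hn : 1 ≤ n)
    (hc0 : ∀ k, n ≤ k → 0 ≤ c k) (hc : ∀ k, n ≤ k → c (k + 1) ≤ c k)
    (hkc : ∀ k : ℕ, n ≤ k → k * c k ≤ n * c n) (u : ℝ) :
    |∑ k ∈ Ico n N, c k * Real.sin (k * u)| ≤ 6 * (n * c n) := by
  have hcn : 0 ≤ n * c n := mul_nonneg (by positivity) (hc0 n le_rfl)
  have pos : ∀ u, 0 < u → u ≤ Real.pi →
      |∑ k ∈ Ico n N, c k * Real.sin (k * u)| ≤ 6 * (n * c n) := by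
    intro u hu hu'
    have hπ4 := Real.pi_le_four
    set m := ⌊Real.pi / u⌋₊ with hm
    have hmle : (m : ℝ) ≤ Real.pi / u := Nat.floor_le (div_pos Real.pi_pos hu).le
    have hlt : Real.pi / u < m + 1 := Nat.lt_floor_add_one _
    have hm1 : 1 ≤ m := Nat.le_floor (by rw [le_div_iff₀ hu]; simpa using hu')
    have hmu : m * u ≤ Real.pi := by rwa [le_div_iff₀ hu] at hmle
    -- Up to `π/u` one uses `|sin ku| ≤ ku` and `k c_k ≤ n c_n`: at most `m` terms of size `u n
    -- c_n`, with `mu ≤ π ≤ 4`.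
    have hlow : ∀ M, M ≤ m → |∑ k ∈ Ico n M, c k * Real.sin (k * u)| ≤ 4 * (n * c n) := by
      intro M hM
      calc _ ≤ ∑ k ∈ Ico n M, (n * c n) * u := by
            refine (abs_sum_le_sum_abs _ _).trans (sum_le_sum fun k hk => ?_)
            have hk := (mem_Ico.mp hk).1
            rw [abs_mul, abs_of_nonneg (hc0 k hk)]
            have h1 : |Real.sin (k * u)| ≤ k * u := by
              refine Real.abs_sin_le_abs.trans_eq (abs_of_nonneg (by positivity))
            have := mul_le_mul_of_nonneg_left h1 (hc0 k hk)
            have := mul_le_mul_of_nonneg_right (hkc k hk) hu.le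
            linarith
        _ = ((M - n : ℕ) : ℝ) * u * (n * c n) := by simp; ring
        _ ≤ m * u * (n * c n) := by
            gcongr
            lia
        _ ≤ 4 * (n * c n) := mul_le_mul_of_nonneg_right (by linarith) hcn
    -- Abel's inequality gives `c_M π/u ≤ c_M (m + 1) ≤ 2 M c_M`.
    have htail : ∀ M, n ≤ M → m ≤ M →
        |∑ k ∈ Ico M N, c k * Real.sin (k * u)| ≤ 2 * (n * c n) := by
      intro M hnM hmM
      have h := abs_sum_mul_cos_le hu hu' (Real.pi / 2) N (fun k hk => hc0 k (hnM.trans hk))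
        (fun k hk => hc k (hnM.trans hk)) (m := M)
      simp only [Real.cos_sub_pi_div_two] at h
      refine h.trans ?_
      have hM1 : (1 : ℝ) ≤ M := by exact_mod_cast hn.trans hnM
      have hmM' : (m : ℝ) ≤ M := by exact_mod_cast hmM
      have := hkc M hnM
      have := hc0 M hnM
      nlinarith
    rcases le_or_gt m n with h | h
    · linarith [htail n le_rfl h]
    rcases le_or_gt N m with h' | h'
    · linarith [hlow N h']
    · rw [← sum_Ico_consecutive _ h.le h'.le]
      refine (abs_add_le _ _).trans ?_
      linarith [hlow m le_rfl, htail m h.le le_rfl]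
  have pos' : ∀ u, 0 ≤ u → u ≤ Real.pi →
      |∑ k ∈ Ico n N, c k * Real.sin (k * u)| ≤ 6 * (n * c n) := by
    intro u hu hu'
    rcases hu.eq_or_lt with rfl | hu
    · simpa using hcn
    · exact pos u hu hu'
  -- Periodicity moves the point into `[-π, π)`, and oddness of the sine sum then into `[0, π]`.
  obtain ⟨v, hv, hv'⟩ := (sum_mul_cos_periodic c (Ico n N) (Real.pi / 2)).exists_mem_Ico
    Real.two_pi_pos u (-Real.pi)
  simp only [Real.cos_sub_pi_div_two] at hv'
  rw [hv']
  rcases le_or_gt 0 v with h | h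
  · exact pos' v h (by linarith [hv.2])
  · have := pos' (-v) (by linarith) (by linarith [hv.1])
    simpa [mul_neg, sum_neg_distrib] using this

/-! ### Orthogonality, Fejér means and Fejér's theorem -/

theorem integral_cos_int_mul_sub (m : ℤ) (γ : ℝ) :
    ∫ t in (0 : ℝ)..(2 * Real.pi), Real.cos (m * t - γ)
      = if m = 0 then 2 * Real.pi * Real.cos γ else 0 := by
  split_ifs with h
  · simp [h]
  · have hm : (m : ℝ) ≠ 0 := by exact_mod_cast h
    rw [intervalIntegral.integral_comp_mul_sub (fun x => Real.cos x) hm, integral_cos]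
    rw [show (m : ℝ) * (2 * Real.pi) - γ = (m * 0 - γ) + m * (2 * Real.pi) by ring,
      Real.sin_add_int_mul_two_pi]
    simp

theorem integral_cos_mul_cos (j k : ℕ) (hj : 1 ≤ j) (γ δ : ℝ) :
    ∫ t in (0 : ℝ)..(2 * Real.pi), Real.cos (j * t - γ) * Real.cos (k * t - δ)
      = if j = k then Real.pi * Real.cos (γ - δ) else 0 := by
  have h1 : ∀ t : ℝ, Real.cos (j * t - γ) * Real.cos (k * t - δ)
      = (Real.cos (((j - k : ℤ) : ℝ) * t - (γ - δ))
        + Real.cos (((j + k : ℤ) : ℝ) * t - (γ + δ))) * (1 / 2) := by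
    intro t
    have := Real.two_mul_cos_mul_cos (j * t - γ) (k * t - δ)
    push_cast
    rw [show ((j : ℝ) - k) * t - (γ - δ) = j * t - γ - (k * t - δ) by ring,
      show ((j : ℝ) + k) * t - (γ + δ) = j * t - γ + (k * t - δ) by ring]
    linarith
  have hjk : (j + k : ℤ) ≠ 0 := by lia
  simp_rw [h1]
  rw [intervalIntegral.integral_mul_const, intervalIntegral.integral_add
    (Continuous.intervalIntegrable (by fun_prop) _ _)
    (Continuous.intervalIntegrable (by fun_prop) _ _),
    integral_cos_int_mul_sub, integral_cos_int_mul_sub, if_neg hjk]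
  rcases eq_or_ne j k with h | h
  · rw [if_pos h, if_pos (by lia)]; ring
  · rw [if_neg h, if_neg (by lia)]; ring

theorem integral_fejerKernel (N : ℕ) :
    ∫ t in (0 : ℝ)..(2 * Real.pi), fejerKernel N t = 2 * Real.pi := by
  unfold fejerKernel
  rw [intervalIntegral.integral_add (by simp)
    (Continuous.intervalIntegrable (by fun_prop) _ _), intervalIntegral.integral_const_mul,
    intervalIntegral.integral_finsetSum fun k _ =>
      Continuous.intervalIntegrable (by fun_prop) _ _,
    sum_eq_zero]
  · simp
  · intro k hk
    have hk0 : (k : ℤ) ≠ 0 := by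
      have := (mem_Ico.mp hk).1
      lia
    have := integral_cos_int_mul_sub k 0
    rw [if_neg hk0] at this
    rw [intervalIntegral.integral_const_mul]
    simp only [Int.cast_natCast, sub_zero] at this
    rw [this, mul_zero]

theorem fejerSum_eq_integral {f : ℝ → ℝ} (hf : Continuous f) (N : ℕ) (x : ℝ) :
    fejerSum N f x
      = 1 / (2 * Real.pi) * ∫ t in (0 : ℝ)..(2 * Real.pi), f t * fejerKernel N (x - t) := by
  have h1 : ∀ t, f t * fejerKernel N (x - t) = f t * Real.cos ((0 : ℕ) * t)
      + ∑ k ∈ Ico 1 N, 2 * (1 - (k : ℝ) / N) *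
        (f t * Real.cos (k * t) * Real.cos (k * x) + f t * Real.sin (k * t) * Real.sin (k * x)) := by
    intro t
    unfold fejerKernel
    rw [mul_add, mul_sum, mul_sum]
    congr 1
    · simp
    · refine sum_congr rfl fun k _ => ?_
      rw [mul_sub, Real.cos_sub]; ring
  simp_rw [h1]
  rw [intervalIntegral.integral_add (Continuous.intervalIntegrable (by fun_prop) _ _)
    (Continuous.intervalIntegrable (by fun_prop) _ _), intervalIntegral.integral_finsetSum
    fun k _ => Continuous.intervalIntegrable (by fun_prop) _ _]
  unfold fejerSum
  rw [mul_add, mul_sum]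
  congr 1
  · unfold fourierCos
    field_simp
  · refine sum_congr rfl fun k _ => ?_
    rw [intervalIntegral.integral_const_mul, intervalIntegral.integral_add
      (Continuous.intervalIntegrable (by fun_prop) _ _)
      (Continuous.intervalIntegrable (by fun_prop) _ _), intervalIntegral.integral_mul_const,
      intervalIntegral.integral_mul_const]
    unfold fourierCos fourierSin
    field_simp

theorem abs_fejerSum_le {f : ℝ → ℝ} (hf : Continuous f) {B : ℝ} (hB : ∀ x, |f x| ≤ B) {N : ℕ}
    (hN : 1 ≤ N) (x : ℝ) : |fejerSum N f x| ≤ B := by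
  have hFc : Continuous fun t => fejerKernel N (x - t) :=
    (continuous_fejerKernel N).comp (by fun_prop)
  rw [fejerSum_eq_integral hf, abs_mul, abs_of_pos (by positivity), one_div,
    inv_mul_le_iff₀ Real.two_pi_pos, ← Real.norm_eq_abs]
  calc _ ≤ ∫ t in (0 : ℝ)..(2 * Real.pi), B * fejerKernel N (x - t) := by
        refine intervalIntegral.norm_integral_le_of_norm_le Real.two_pi_pos.le
          (Eventually.of_forall fun t _ => ?_)
          (Continuous.intervalIntegrable (by fun_prop) _ _)
        rw [norm_mul, Real.norm_eq_abs, Real.norm_eq_abs, abs_of_nonneg (fejerKernel_nonneg hN _)]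
        exact mul_le_mul_of_nonneg_right (hB t) (fejerKernel_nonneg hN _)
    _ = 2 * Real.pi * B := by
        rw [intervalIntegral.integral_const_mul,
          integral_comp_sub_left_of_periodic (fejerKernel_periodic N), integral_fejerKernel]
        ring

/-- Fejér's theorem. -/
theorem tendsto_fejerSum {f : ℝ → ℝ} (hf : Continuous f)
    (hfp : Function.Periodic f (2 * Real.pi)) (x : ℝ) :
    Tendsto (fun N => fejerSum N f x) atTop (𝓝 (f x)) := by
  have hπ := Real.pi_pos
  have hper : ∀ N, Function.Periodic (fun t => fejerKernel N t * f (x - t)) (2 * Real.pi) := by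
    intro N t
    have h2 := hfp (x - (t + 2 * Real.pi))
    rw [show x - (t + 2 * Real.pi) + 2 * Real.pi = x - t by ring] at h2
    simp only [fejerKernel_periodic N t, h2]
  have hshift : ∀ g : ℝ → ℝ, Function.Periodic g (2 * Real.pi) →
      ∫ t in Set.Ioc (-Real.pi) Real.pi, g t = ∫ t in (0 : ℝ)..(2 * Real.pi), g t := by
    intro g hg
    rw [← intervalIntegral.integral_of_le (by linarith)]
    have := hg.intervalIntegral_add_eq (-Real.pi) 0
    rwa [show -Real.pi + 2 * Real.pi = Real.pi by ring, zero_add] at this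
  have key : ∀ N, fejerSum N f x = ∫ t in Set.Ioc (-Real.pi) Real.pi,
      (1 / (2 * Real.pi) * fejerKernel N t) • f (x - t) := by
    intro N
    have h1 := integral_comp_sub_left_of_periodic (hper N) x
    simp only [sub_sub_cancel] at h1
    have h2 : ∫ t in Set.Ioc (-Real.pi) Real.pi, (1 / (2 * Real.pi) * fejerKernel N t) • f (x - t)
        = 1 / (2 * Real.pi) * ∫ t in Set.Ioc (-Real.pi) Real.pi, fejerKernel N t * f (x - t) := by
      rw [← integral_const_mul]
      exact integral_congr_ae (Eventually.of_forall fun t => by simp; ring)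
    rw [h2, hshift _ (hper N), ← h1, fejerSum_eq_integral hf]
    simp only [mul_comm]
  simp_rw [key]
  have hnhds : Set.Ioc (-Real.pi) Real.pi ∈ 𝓝[Set.Ioc (-Real.pi) Real.pi] (0 : ℝ) :=
    self_mem_nhdsWithin
  have hcx : Continuous fun t => f (x - t) := by fun_prop
  refine tendsto_setIntegral_peak_smul_of_integrableOn_of_tendsto (x₀ := (0 : ℝ))
    measurableSet_Ioc measurableSet_Ioc subset_rfl hnhds (by simp)
    ?_ ?_ ?_ ?_ hcx.integrableOn_Ioc ?_
  · filter_upwards [eventually_ge_atTop 1] with N hN t _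
    exact mul_nonneg (by positivity) (fejerKernel_nonneg hN t)
  · intro U hU h0
    obtain ⟨δ, hδ, hball⟩ := Metric.isOpen_iff.mp hU 0 h0
    rw [Metric.tendstoUniformlyOn_iff]
    intro ε hε
    have hlim : Tendsto (fun N : ℕ => 1 / (2 * Real.pi) * (2 * (Real.pi / δ) ^ 2 / (N : ℝ))) atTop
        (𝓝 (1 / (2 * Real.pi) * 0)) :=
      (tendsto_const_div_atTop_nhds_zero_nat _).const_mul _
    rw [mul_zero] at hlim
    filter_upwards [eventually_ge_atTop 1, hlim.eventually_lt_const hε] with N hN hNε t ht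
    have ht1 : δ ≤ |t| := by
      by_contra! hlt
      exact ht.2 (hball (by simpa using hlt))
    have ht2 : |t| ≤ Real.pi := abs_le.mpr ⟨ht.1.1.le, ht.1.2⟩
    rw [Pi.zero_apply, dist_zero_left, Real.norm_eq_abs,
      abs_of_nonneg (mul_nonneg (by positivity) (fejerKernel_nonneg hN t))]
    exact (mul_le_mul_of_nonneg_left (fejerKernel_le hN hδ ht1 ht2) (by positivity)).trans_lt hNε
  · have : ∀ N, ∫ t in Set.Ioc (-Real.pi) Real.pi, 1 / (2 * Real.pi) * fejerKernel N t = 1 := by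
      intro N
      rw [integral_const_mul, hshift _ (fejerKernel_periodic N), integral_fejerKernel]
      field_simp
    simp only [this]
    exact tendsto_const_nhds
  · exact Eventually.of_forall fun N =>
      (continuous_const.mul (continuous_fejerKernel N)).aestronglyMeasurable
  · have : Tendsto (fun t => f (x - t)) (𝓝 0) (𝓝 (f (x - 0))) := hcx.tendsto 0
    rw [sub_zero] at this
    exact this.mono_left nhdsWithin_le_nhds

/-- Below `n` the multipliers differ by `k/n - k/N = (1 - n/N) k/n`; from `n` on only the larger
mean contributes. Comparing two Fejér means keeps all sums finite, so convergence of the Fourier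
series of `f` is never needed. -/
theorem fejerSum_sub_fejerSum (f : ℝ → ℝ) {n N : ℕ} (hn : 1 ≤ n) (hnN : n ≤ N) (x : ℝ) :
    fejerSum N f x - fejerSum n f x
      = (1 - (n : ℝ) / N) * (1 / n) * ∑ k ∈ Ico 1 n, k *
          (fourierCos f k * Real.cos (k * x) + fourierSin f k * Real.sin (k * x))
        + ∑ k ∈ Ico n N, (1 - (k : ℝ) / N) *
          (fourierCos f k * Real.cos (k * x) + fourierSin f k * Real.sin (k * x)) := by
  have hn0 : (n : ℝ) ≠ 0 := by positivity
  have hN0 : (N : ℝ) ≠ 0 := by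
    have : 1 ≤ N := hn.trans hnN
    positivity
  unfold fejerSum
  rw [← sum_Ico_consecutive _ hn hnN, add_sub_add_left_eq_sub, add_sub_right_comm,
    ← sum_sub_distrib, mul_sum]
  congr 1
  refine sum_congr rfl fun k _ => ?_
  field_simp
  ring

theorem abs_sub_fejerSum_le {f : ℝ → ℝ} (hf : Continuous f)
    (hfp : Function.Periodic f (2 * Real.pi)) {n : ℕ} {x B : ℝ}
    (h : ∀ N, n ≤ N → |fejerSum N f x - fejerSum n f x| ≤ B) : |f x - fejerSum n f x| ≤ B :=
  le_of_tendsto ((tendsto_fejerSum hf hfp x).sub_const _).abs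
    ((eventually_ge_atTop n).mono fun N hN => h N hN)

/-! ### Phase polynomials and de la Vallée Poussin means -/

/-- The trigonometric polynomial with amplitudes `w` and phases `θ`. -/
noncomputable def phasePoly (a₀ : ℝ) (w θ : ℕ → ℝ) (N : ℕ) : ℝ → ℝ := fun x =>
  a₀ + ∑ k ∈ Ico 1 N, w k * Real.cos (k * x - θ k)

theorem continuous_phasePoly (a₀ : ℝ) (w θ : ℕ → ℝ) (N : ℕ) : Continuous (phasePoly a₀ w θ N) := by
  unfold phasePoly; fun_prop

theorem phasePoly_periodic (a₀ : ℝ) (w θ : ℕ → ℝ) (N : ℕ) :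
    Function.Periodic (phasePoly a₀ w θ N) (2 * Real.pi) := by
  intro u
  unfold phasePoly
  congr 1
  refine sum_congr rfl fun k _ => ?_
  rw [show (k : ℝ) * (u + 2 * Real.pi) - θ k = k * u - θ k + k * (2 * Real.pi) by ring,
    Real.cos_add_nat_mul_two_pi]

theorem integral_phasePoly_mul_cos (a₀ : ℝ) (w θ : ℕ → ℝ) (N k : ℕ) (δ : ℝ) :
    ∫ t in (0 : ℝ)..(2 * Real.pi), phasePoly a₀ w θ N t * Real.cos (k * t - δ)
      = a₀ * (if k = 0 then 2 * Real.pi * Real.cos δ else 0)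
        + Real.pi * (if k ∈ Ico 1 N then w k * Real.cos (θ k - δ) else 0) := by
  have h1 : ∀ t, phasePoly a₀ w θ N t * Real.cos (k * t - δ) = a₀ * Real.cos (k * t - δ)
      + ∑ j ∈ Ico 1 N, w j * (Real.cos (j * t - θ j) * Real.cos (k * t - δ)) := by
    intro t
    unfold phasePoly
    rw [add_mul, sum_mul]
    simp only [mul_assoc]
  simp_rw [h1]
  rw [intervalIntegral.integral_add (Continuous.intervalIntegrable (by fun_prop) _ _)
    (Continuous.intervalIntegrable (by fun_prop) _ _), intervalIntegral.integral_finsetSum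
    fun k _ => Continuous.intervalIntegrable (by fun_prop) _ _,
    intervalIntegral.integral_const_mul]
  have h2 := integral_cos_int_mul_sub k δ
  simp only [Int.cast_natCast, Nat.cast_eq_zero] at h2
  rw [h2]
  congr 1
  rw [← sum_ite_eq' (Ico 1 N) k fun j => w j * Real.cos (θ j - δ), mul_sum]
  refine sum_congr rfl fun j hj => ?_
  rw [intervalIntegral.integral_const_mul, integral_cos_mul_cos j k (mem_Ico.mp hj).1]
  split_ifs with h
  · subst h; ring
  · simp

theorem fourierCos_phasePoly_zero (a₀ : ℝ) (w θ : ℕ → ℝ) (N : ℕ) :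
    fourierCos (phasePoly a₀ w θ N) 0 = 2 * a₀ := by
  have h := integral_phasePoly_mul_cos a₀ w θ N 0 0
  simp only [sub_zero] at h
  rw [fourierCos, h]
  have := Real.pi_ne_zero
  simp
  field_simp

theorem fourierCos_phasePoly (a₀ : ℝ) (w θ : ℕ → ℝ) (N : ℕ) {k : ℕ} (hk : 1 ≤ k) :
    fourierCos (phasePoly a₀ w θ N) k = if k < N then w k * Real.cos (θ k) else 0 := by
  have h := integral_phasePoly_mul_cos a₀ w θ N k 0
  simp only [sub_zero] at h
  have hk0 : k ≠ 0 := by lia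
  have := Real.pi_ne_zero
  rw [fourierCos, h, if_neg hk0, mul_zero, zero_add, ← mul_assoc, one_div_mul_cancel this, one_mul]
  simp [mem_Ico, hk]

theorem fourierSin_phasePoly (a₀ : ℝ) (w θ : ℕ → ℝ) (N : ℕ) {k : ℕ} (hk : 1 ≤ k) :
    fourierSin (phasePoly a₀ w θ N) k = if k < N then w k * Real.sin (θ k) else 0 := by
  have h := integral_phasePoly_mul_cos a₀ w θ N k (Real.pi / 2)
  simp only [Real.cos_sub_pi_div_two] at h
  have hk0 : k ≠ 0 := by lia
  have := Real.pi_ne_zero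
  rw [fourierSin, h, if_neg hk0, mul_zero, zero_add, ← mul_assoc, one_div_mul_cancel this, one_mul]
  simp [mem_Ico, hk]

theorem fourier_harmonic_phasePoly (a₀ : ℝ) (w θ : ℕ → ℝ) (N : ℕ) {k : ℕ} (hk : 1 ≤ k) (y : ℝ) :
    fourierCos (phasePoly a₀ w θ N) k * Real.cos y + fourierSin (phasePoly a₀ w θ N) k * Real.sin y
      = if k < N then w k * Real.cos (y - θ k) else 0 := by
  rw [fourierCos_phasePoly _ _ _ _ hk, fourierSin_phasePoly _ _ _ _ hk]
  split_ifs
  · rw [Real.cos_sub]; ring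
  · simp

/-- The multipliers of the Fejér method, extended by zero. -/
noncomputable def fejerWeight (m k : ℕ) : ℝ := if k < m then 1 - (k : ℝ) / m else 0

theorem fejerSum_phasePoly (a₀ : ℝ) (w θ : ℕ → ℝ) (N m : ℕ) (x : ℝ) :
    fejerSum m (phasePoly a₀ w θ N) x
      = a₀ + ∑ k ∈ Ico 1 N, fejerWeight m k * (w k * Real.cos (k * x - θ k)) := by
  unfold fejerSum fejerWeight
  rw [fourierCos_phasePoly_zero, mul_div_cancel_left₀ _ two_ne_zero]
  congr 1
  have h1 : ∀ k ∈ Ico 1 m, (1 - (k : ℝ) / m) *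
      (fourierCos (phasePoly a₀ w θ N) k * Real.cos (k * x)
        + fourierSin (phasePoly a₀ w θ N) k * Real.sin (k * x))
      = if k < N then (1 - (k : ℝ) / m) * (w k * Real.cos (k * x - θ k)) else 0 := by
    intro k hk
    rw [fourier_harmonic_phasePoly _ _ _ _ (mem_Ico.mp hk).1, mul_ite, mul_zero]
  rw [sum_congr rfl h1]
  simp only [ite_mul, zero_mul]
  rw [← sum_filter, ← sum_filter]
  refine sum_congr ?_ fun _ _ => rfl
  ext k
  simp only [mem_filter, mem_Ico]
  tauto

theorem fejerSum_add {f g : ℝ → ℝ} (hf : Continuous f) (hg : Continuous g) (m : ℕ) (x : ℝ) :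
    fejerSum m (fun t => f t + g t) x = fejerSum m f x + fejerSum m g x := by
  rw [fejerSum_eq_integral hf, fejerSum_eq_integral hg,
    fejerSum_eq_integral (f := fun t => f t + g t) (hf.add hg), ← mul_add, ← intervalIntegral.integral_add]
  · simp only [add_mul]
  all_goals
    refine Continuous.intervalIntegrable (Continuous.mul (by fun_prop) ?_) _ _
    exact (continuous_fejerKernel m).comp (by fun_prop)

theorem fejerSum_sub {f g : ℝ → ℝ} (hf : Continuous f) (hg : Continuous g) (m : ℕ) (x : ℝ) :
    fejerSum m (fun t => f t - g t) x = fejerSum m f x - fejerSum m g x := by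
  have := fejerSum_add (hf.sub hg) hg m x
  simp only [Pi.sub_apply, sub_add_cancel] at this
  rw [this, add_sub_cancel_right]
  rfl

/-- The multipliers of the de la Vallée Poussin means `2 σ_{2n-1} - σ_{n-1}`. -/
theorem two_mul_fejerWeight_sub_of_lt {n k : ℕ} (h : k < n) :
    2 * fejerWeight (2 * n) k - fejerWeight n k = 1 := by
  unfold fejerWeight
  rw [if_pos h, if_pos (by lia)]
  have : (n : ℝ) ≠ 0 := by
    have : 1 ≤ n := by lia
    positivity
  push_cast
  field_simp
  ring

theorem two_mul_fejerWeight_sub_of_le {n k : ℕ} (h : 2 * n ≤ k) :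
    2 * fejerWeight (2 * n) k - fejerWeight n k = 0 := by
  unfold fejerWeight
  rw [if_neg (by lia), if_neg (by lia)]
  ring

theorem two_mul_fejerWeight_sub_le_one (n k : ℕ) :
    2 * fejerWeight (2 * n) k - fejerWeight n k ≤ 1 := by
  rcases lt_or_ge k n with h | h
  · exact (two_mul_fejerWeight_sub_of_lt h).le
  rcases le_or_gt (2 * n) k with h' | h'
  · rw [two_mul_fejerWeight_sub_of_le h']; exact zero_le_one
  · unfold fejerWeight
    rw [if_pos h', if_neg (not_lt.mpr h), sub_zero]
    have hn : (0 : ℝ) < n := by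
      have : 1 ≤ n := by lia
      positivity
    have hk : (n : ℝ) ≤ k := by exact_mod_cast h
    have : 1 / 2 ≤ (k : ℝ) / ((2 * n : ℕ) : ℝ) := by
      push_cast
      rw [div_le_div_iff₀ two_pos (by positivity)]
      linarith
    linarith

theorem exists_phasePoly_of_mem_trigPoly {n : ℕ} {T : ℝ → ℝ} (hT : T ∈ trigPoly n) :
    ∃ (a₀ : ℝ) (a b : ℕ → ℝ), T = fun x =>
      phasePoly a₀ a (fun _ => 0) n x + phasePoly 0 b (fun _ => Real.pi / 2) n x := by
  obtain ⟨a, b, h⟩ := hT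
  refine ⟨a 0, a, b, funext fun x => ?_⟩
  rw [h, sum_add_distrib]
  simp only [phasePoly, sub_zero, Real.cos_sub_pi_div_two]
  ring

theorem trigPoly_continuous {n : ℕ} {T : ℝ → ℝ} (hT : T ∈ trigPoly n) : Continuous T := by
  obtain ⟨a₀, a, b, rfl⟩ := exists_phasePoly_of_mem_trigPoly hT
  exact (continuous_phasePoly _ _ _ _).add (continuous_phasePoly _ _ _ _)

theorem two_mul_fejerSum_sub_trigPoly {n : ℕ} {T : ℝ → ℝ} (hT : T ∈ trigPoly n) (x : ℝ) :
    2 * fejerSum (2 * n) T x - fejerSum n T x = T x := by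
  have hp : ∀ (a₀ : ℝ) (w θ : ℕ → ℝ), 2 * fejerSum (2 * n) (phasePoly a₀ w θ n) x
      - fejerSum n (phasePoly a₀ w θ n) x = phasePoly a₀ w θ n x := by
    intro a₀ w θ
    rw [fejerSum_phasePoly, fejerSum_phasePoly, phasePoly, mul_add, mul_sum,
      add_sub_add_comm, ← sum_sub_distrib]
    congr 1
    · ring
    · refine sum_congr rfl fun k hk => ?_
      rw [← mul_assoc, ← sub_mul, two_mul_fejerWeight_sub_of_lt (mem_Ico.mp hk).2, one_mul]
  obtain ⟨a₀, a, b, rfl⟩ := exists_phasePoly_of_mem_trigPoly hT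
  rw [fejerSum_add (continuous_phasePoly _ _ _ _) (continuous_phasePoly _ _ _ _),
    fejerSum_add (continuous_phasePoly _ _ _ _) (continuous_phasePoly _ _ _ _)]
  linear_combination hp a₀ a (fun _ => 0) + hp 0 b fun _ => Real.pi / 2

/-- With `V = 2σ_{2n-1} - σ_{n-1}` one has `f - Vf = (f - T) - V(f - T)`, of size at most `(1 + 2 +
1)B`. At `0` the left side is `∑ (1 - v_k) w_k cos θ_k`, whose terms are non-negative, with `v_k =
0` for `k ≥ 2n`. -/
theorem sum_le_four_mul_of_abs_sub_le {n : ℕ} (hn : 1 ≤ n) {w θ : ℕ → ℝ} {N : ℕ}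
    (hw : ∀ k ∈ Ico 1 N, 0 ≤ w k * Real.cos (θ k)) {T : ℝ → ℝ} (hT : T ∈ trigPoly n) {B : ℝ}
    (hB : ∀ x, |phasePoly 0 w θ N x - T x| ≤ B) :
    ∑ k ∈ Ico (2 * n) N, w k * Real.cos (θ k) ≤ 4 * B := by
  have hfc := continuous_phasePoly 0 w θ N
  have hTc := trigPoly_continuous hT
  have h1 := abs_fejerSum_le (hfc.sub hTc) hB (N := 2 * n) (by lia) 0
  have h2 := abs_fejerSum_le (hfc.sub hTc) hB hn 0
  have h3 := hB 0
  have e1 := fejerSum_sub hfc hTc (2 * n) 0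
  have e2 := fejerSum_sub hfc hTc n 0
  have hT0 := two_mul_fejerSum_sub_trigPoly hT 0
  have e1' : fejerSum (2 * n) (phasePoly 0 w θ N - T) 0 = _ := e1
  have e2' : fejerSum n (phasePoly 0 w θ N - T) 0 = _ := e2
  rw [e1'] at h1
  rw [e2'] at h2
  have hsum : phasePoly 0 w θ N 0 - (2 * fejerSum (2 * n) (phasePoly 0 w θ N) 0
      - fejerSum n (phasePoly 0 w θ N) 0)
      = ∑ k ∈ Ico 1 N, (1 - (2 * fejerWeight (2 * n) k - fejerWeight n k))
        * (w k * Real.cos (θ k)) := by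
    rw [fejerSum_phasePoly, fejerSum_phasePoly, phasePoly]
    simp only [mul_zero, zero_sub, Real.cos_neg, zero_add]
    rw [mul_sum, ← sum_sub_distrib, ← sum_sub_distrib]
    exact sum_congr rfl fun k _ => by ring
  have hle : ∑ k ∈ Ico (2 * n) N, w k * Real.cos (θ k)
      ≤ ∑ k ∈ Ico 1 N, (1 - (2 * fejerWeight (2 * n) k - fejerWeight n k))
        * (w k * Real.cos (θ k)) := by
    have hsub : Ico (2 * n) N ⊆ Ico 1 N := Ico_subset_Ico_left (by lia)
    refine le_trans (sum_le_sum fun k hk => ?_) (sum_le_sum_of_subset_of_nonneg hsub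
      fun k hk _ => mul_nonneg ?_ (hw k hk))
    · rw [two_mul_fejerWeight_sub_of_le (mem_Ico.mp hk).1, sub_zero, one_mul]
    · linarith [two_mul_fejerWeight_sub_le_one n k]
  rw [abs_le] at h1 h2 h3
  linarith

/-! ### From explicit derivatives to bounds for best approximation -/

theorem ofReal_le_uniformNorm {S c : ℝ} (hc : 0 < c) {h : ℝ → ℝ}
    (hS : ∀ B, (∀ x, |h x| ≤ B) → S ≤ c * B) :
    ENNReal.ofReal S ≤ ENNReal.ofReal c * uniformNorm h := by
  by_cases htop : uniformNorm h = ⊤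
  · rw [htop, ENNReal.mul_top (by simpa using hc)]; exact le_top
  · rw [← ENNReal.ofReal_toReal htop, ← ENNReal.ofReal_mul hc.le]
    refine ENNReal.ofReal_le_ofReal (hS _ fun x => ?_)
    have hx : ‖h x‖ₑ ≤ uniformNorm h := le_iSup (fun x => ‖h x‖ₑ) x
    have := ENNReal.toReal_mono htop hx
    rwa [toReal_enorm, Real.norm_eq_abs] at this

theorem uniformNorm_le {h : ℝ → ℝ} {B : ℝ} (hB : ∀ x, |h x| ≤ B) :
    uniformNorm h ≤ ENNReal.ofReal B :=
  iSup_le fun x => by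
    rw [Real.enorm_eq_ofReal_abs]
    exact ENNReal.ofReal_le_ofReal (hB x)

theorem phasePoly_mem_psiBetaClass {ψ : ℝ → ℝ} (hψ : ∀ k : ℕ, 1 ≤ k → 0 < ψ k) {β p : ℝ}
    {w η : ℕ → ℝ} {N : ℕ} (hφ : periodNorm p (phasePoly 0 w η N) ≤ 1) :
    phasePoly 0 (fun k => ψ k * w k) (fun k => η k + β * Real.pi / 2) N ∈ psiBetaClass ψ β p := by
  have hmem : ∀ r : ℝ, PeriodicLp r (phasePoly 0 w η N) := fun r =>
    ⟨phasePoly_periodic _ _ _ _, Continuous.memLp_period (continuous_phasePoly _ _ _ _) _⟩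
  refine ⟨continuous_phasePoly _ _ _ _, phasePoly_periodic _ _ _ _, phasePoly 0 w η N,
    ⟨hmem p, hφ⟩, hmem 1, ?_, fun k hk x => ?_⟩
  · rw [fourierCos_phasePoly_zero, mul_zero]
  · rw [fourier_harmonic_phasePoly _ _ _ _ hk, fourier_harmonic_phasePoly _ _ _ _ hk]
    split_ifs
    · have := (hψ k hk).ne'
      rw [show (k : ℝ) * x + β * Real.pi / 2 - (η k + β * Real.pi / 2) = k * x - η k by ring]
      field_simp
    · simp

/-- This reduces a lower bound to the choice of one polynomial derivative in the unit ball whose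
phases make every harmonic of `f` non-negative at the origin. -/
theorem ofReal_sum_le_bestApprox {ψ : ℝ → ℝ} (hψ : ∀ k : ℕ, 1 ≤ k → 0 < ψ k) {β p : ℝ}
    {w η : ℕ → ℝ} {n N : ℕ} (hn : 1 ≤ n) (hφ : periodNorm p (phasePoly 0 w η N) ≤ 1)
    (hw : ∀ k ∈ Ico 1 N, 0 ≤ ψ k * w k * Real.cos (η k + β * Real.pi / 2)) :
    ENNReal.ofReal (∑ k ∈ Ico (2 * n) N, ψ k * w k * Real.cos (η k + β * Real.pi / 2))
      ≤ ENNReal.ofReal 4 * bestApprox (psiBetaClass ψ β p) n := by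
  have hf := phasePoly_mem_psiBetaClass (β := β) hψ hφ
  unfold bestApprox
  refine le_trans ?_ (mul_le_mul_right (le_iSup₂_of_le _ hf le_rfl) _)
  rw [ENNReal.mul_iInf_of_ne (by simp) ENNReal.ofReal_ne_top]
  refine le_iInf fun T => ?_
  rw [ENNReal.mul_iInf_of_ne (by simp) ENNReal.ofReal_ne_top]
  refine le_iInf fun hT => ofReal_le_uniformNorm four_pos fun B hB => ?_
  exact sum_le_four_mul_of_abs_sub_le hn hw hT hB

theorem fejerSum_mem_trigPoly (n : ℕ) (f : ℝ → ℝ) : fejerSum n f ∈ trigPoly n := by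
  refine ⟨fun k => if k = 0 then fourierCos f 0 / 2 else (1 - (k : ℝ) / n) * fourierCos f k,
    fun k => (1 - (k : ℝ) / n) * fourierSin f k, fun x => ?_⟩
  unfold fejerSum
  simp only [if_true]
  congr 1
  refine sum_congr rfl fun k hk => ?_
  have : k ≠ 0 := by
    have := (mem_Ico.mp hk).1
    lia
  rw [if_neg this]
  ring

theorem bestApprox_le_fejerDeviation (F : Set (ℝ → ℝ)) (n : ℕ) :
    bestApprox F n ≤ fejerDeviation F n :=
  iSup₂_mono fun f _ => iInf₂_le_of_le _ (fejerSum_mem_trigPoly n f) le_rfl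

theorem fejerDeviation_le {F : Set (ℝ → ℝ)} {n : ℕ} {B : ℝ}
    (h : ∀ f ∈ F, ∀ x, |f x - fejerSum n f x| ≤ B) : fejerDeviation F n ≤ ENNReal.ofReal B :=
  iSup₂_le fun f hf => uniformNorm_le (h f hf)

/-- The chain `E ≤ D ≤ C R ≤ C C' E` closes up, so an upper bound for `D` and a lower bound for `E`
give every comparison. -/
theorem sameOrder_of_bounds {E D : ℕ → ℝ≥0∞} {R : ℕ → ℝ} (hED : ∀ n, E n ≤ D n)
    (hD : ∃ C, 0 < C ∧ ∀ n, 1 ≤ n → D n ≤ ENNReal.ofReal (C * R n))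
    (hE : ∃ C, 0 < C ∧ ∀ n, 1 ≤ n → ENNReal.ofReal (R n) ≤ ENNReal.ofReal C * E n) :
    SameOrder E D ∧ SameOrder D fun n => ENNReal.ofReal (R n) := by
  obtain ⟨C, hC, hD⟩ := hD
  obtain ⟨C', hC', hE⟩ := hE
  have hDR : ∀ n, 1 ≤ n → D n ≤ ENNReal.ofReal C * ENNReal.ofReal (R n) := fun n hn => by
    rw [← ENNReal.ofReal_mul hC.le]
    exact hD n hn
  refine ⟨⟨⟨1, one_pos, fun n _ => by simpa using hED n⟩,
    ⟨C.toNNReal * C'.toNNReal, by simp [hC, hC'], fun n hn => ?_⟩⟩,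
    ⟨⟨C.toNNReal, by simpa using hC, hDR⟩, ⟨C'.toNNReal, by simpa using hC', fun n hn =>
      (hE n hn).trans (mul_le_mul_right (hED n) _)⟩⟩⟩
  refine (hDR n hn).trans ((mul_le_mul_right (hE n hn) _).trans_eq ?_)
  rw [← mul_assoc, ENNReal.coe_mul]
  rfl

/-! ### Regularity of the weight -/

/-- By monotone slopes, a convex function that increases once stays above the value reached; that
value is positive, which contradicts the limit zero. -/
theorem ClassM.antitoneOn {g : ℝ → ℝ} (h : ClassM g) : AntitoneOn g (Set.Ici 1) := by
  obtain ⟨hpos, -, hconv, hlim⟩ := h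
  intro a ha b hb hab
  by_contra! hlt
  have hab' : a < b := lt_of_le_of_ne hab (by rintro rfl; exact lt_irrefl _ hlt)
  have hge : ∀ c, b < c → g b ≤ g c := by
    intro c hc
    have hs := hconv.slope_mono_adjacent ha (Set.mem_Ici.mpr (le_trans hb hc.le)) hab' hc
    have h1 : 0 < (g b - g a) / (b - a) := div_pos (by linarith) (by linarith)
    have h2 := h1.trans_le hs
    have h3 := (div_pos_iff_of_pos_right (by linarith : 0 < c - b)).mp h2
    linarith
  have h0 : g b ≤ 0 := ge_of_tendsto hlim ((eventually_gt_atTop b).mono hge)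
  exact absurd (hpos b hb) (not_lt.mpr h0)

/-- The regularity of the sequence `ψ(k)` that the order estimates rest on. -/
structure RegularWeight (u : ℕ → ℝ) (s C : ℝ) : Prop where
  pos : ∀ k, 1 ≤ k → 0 < u k
  mul_rpow_antitone : ∀ k : ℕ, 1 ≤ k → u (k + 1) * ((k + 1 : ℕ) : ℝ) ^ s ≤ u k * (k : ℝ) ^ s
  const_pos : 0 < C
  doubling : ∀ n m : ℕ, 1 ≤ n → n ≤ m → m ≤ 4 * n → u n ≤ C * u m
  sum_le : ∀ n : ℕ, 1 ≤ n → ∑ k ∈ Icc 1 n, u k * (k : ℝ) ^ s ≤ C * (n * (u n * (n : ℝ) ^ s))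

theorem RegularWeight.antitone {u : ℕ → ℝ} {s C : ℝ} (h : RegularWeight u s C) (hs : 0 ≤ s)
    (k : ℕ) (hk : 1 ≤ k) : u (k + 1) ≤ u k := by
  have hk0 : (0 : ℝ) < (k : ℝ) ^ s := Real.rpow_pos_of_pos (by exact_mod_cast hk) s
  refine le_of_mul_le_mul_right ((mul_le_mul_of_nonneg_left ?_ (h.pos _ (by lia)).le).trans
    (h.mul_rpow_antitone k hk)) hk0
  exact Real.rpow_le_rpow (by positivity) (by push_cast; linarith) hs

theorem RegularWeight.le_of_le {u : ℕ → ℝ} {s C : ℝ} (h : RegularWeight u s C) (hs : 0 ≤ s)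
    {n m : ℕ} (hn : 1 ≤ n) (hnm : n ≤ m) : u m ≤ u n := by
  induction m, hnm using Nat.le_induction with
  | base => exact le_rfl
  | succ m hm ih => exact (h.antitone hs m (hn.trans hm)).trans ih

/-- Monotonicity comes from convexity and the zero limit. Doubling and the bound for sums come from
almost monotonicity of `ψ(k) k^{1+s-ε}`; for the sum, `k^s` is split as `k^{1+s-ε} · k^{ε-1}`, and
`∑_{k ≤ n} k^{ε-1} = O(n^ε)`. -/
theorem exists_regularWeight {ψ : ℝ → ℝ} {s : ℝ} (hs : 0 ≤ s) (hM : ClassM (powerWeight ψ s))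
    (hGA : GAPlus fun k : ℕ => powerWeight ψ (1 + s) k) :
    ∃ C, RegularWeight (fun k => ψ k) s C := by
  have hpos : ∀ k : ℕ, 1 ≤ k → 0 < ψ k := by
    intro k hk
    have hk1 : (1 : ℝ) ≤ k := by exact_mod_cast hk
    have := hM.1 k hk1
    unfold powerWeight at this
    exact (mul_pos_iff_of_pos_right (Real.rpow_pos_of_pos (by linarith) s)).mp this
  obtain ⟨ε, hε, -, K₀, hK₀⟩ := hGA
  set K := max K₀ 1 with hKdef
  have hKpos : 0 < K := lt_max_of_lt_right one_pos
  have hK : ∀ l m : ℕ, 1 ≤ l → l ≤ m →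
      ψ l * (l : ℝ) ^ (1 + s - ε) ≤ K * (ψ m * (m : ℝ) ^ (1 + s - ε)) := by
    intro l m hl hlm
    have hl0 : (0 : ℝ) < l := by exact_mod_cast hl
    have hm0 : (0 : ℝ) < m := by exact_mod_cast hl.trans hlm
    have := hK₀ l m hl hlm
    simp only [powerWeight, mul_assoc] at this
    rw [← Real.rpow_add hl0, ← Real.rpow_add hm0, ← sub_eq_add_neg] at this
    exact this.trans (mul_le_mul_of_nonneg_right (le_max_left _ _)
      (mul_nonneg (hpos m (hl.trans hlm)).le (by positivity)))
  obtain ⟨D, hD, hDM⟩ := exists_sum_rpow_le hε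
  have hanti : ∀ k : ℕ, 1 ≤ k → ψ (k + 1 : ℕ) * ((k + 1 : ℕ) : ℝ) ^ s ≤ ψ k * (k : ℝ) ^ s :=
    fun k hk => hM.antitoneOn (Set.mem_Ici.mpr (by exact_mod_cast hk))
      (Set.mem_Ici.mpr (by push_cast; linarith [(Nat.cast_nonneg k : (0 : ℝ) ≤ k)]))
      (by push_cast; linarith)
  have hC1 : ∀ n m : ℕ, 1 ≤ n → n ≤ m → m ≤ 4 * n → ψ n ≤ K * 4 ^ (1 + s) * ψ m := by
    intro n m hn hnm hm4
    have hn0 : (0 : ℝ) < n := by exact_mod_cast hn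
    have hm0 : (0 : ℝ) < m := by exact_mod_cast hn.trans hnm
    have hψm := hpos m (hn.trans hnm)
    have h1 := hK n m hn hnm
    have hnε : (0 : ℝ) < (n : ℝ) ^ ε := by positivity
    -- The exponent `1 + s - ε` may be negative, so the powers `1 + s` and `ε` are estimated
    -- separately.
    have h2 : (m : ℝ) ^ (1 + s - ε) ≤ 4 ^ (1 + s) * (n : ℝ) ^ (1 + s - ε) := by
      rw [Real.rpow_sub hm0, Real.rpow_sub hn0, ← mul_div_assoc,
        ← Real.mul_rpow (by norm_num) hn0.le]
      refine div_le_div₀ (by positivity) (Real.rpow_le_rpow hm0.le (by exact_mod_cast hm4)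
        (by linarith)) hnε (Real.rpow_le_rpow hn0.le (by exact_mod_cast hnm) hε.le)
    have hX : (0 : ℝ) < (n : ℝ) ^ (1 + s - ε) := by positivity
    refine le_of_mul_le_mul_right (h1.trans ?_) hX
    calc K * (ψ m * (m : ℝ) ^ (1 + s - ε))
        ≤ K * (ψ m * (4 ^ (1 + s) * (n : ℝ) ^ (1 + s - ε))) := by gcongr
      _ = _ := by ring
  have hC2 : ∀ n : ℕ, 1 ≤ n →
      ∑ k ∈ Icc 1 n, ψ k * (k : ℝ) ^ s ≤ K * D * (n * (ψ n * (n : ℝ) ^ s)) := by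
    intro n hn
    have hn0 : (0 : ℝ) < n := by exact_mod_cast hn
    have hψn := hpos n hn
    calc ∑ k ∈ Icc 1 n, ψ k * (k : ℝ) ^ s
        ≤ ∑ k ∈ Icc 1 n, K * (ψ n * (n : ℝ) ^ (1 + s - ε)) * (k : ℝ) ^ (ε - 1) := by
          refine sum_le_sum fun k hk => ?_
          obtain ⟨hk1, hkn⟩ := mem_Icc.mp hk
          have hk0 : (0 : ℝ) < k := by exact_mod_cast hk1
          have h1 := mul_le_mul_of_nonneg_right (hK k n hk1 hkn)
            (Real.rpow_nonneg hk0.le (ε - 1))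
          rwa [mul_assoc, ← Real.rpow_add hk0,
            show 1 + s - ε + (ε - 1) = s by ring] at h1
      _ ≤ K * (ψ n * (n : ℝ) ^ (1 + s - ε)) * (D * (n : ℝ) ^ ε) := by
          rw [← mul_sum]
          exact mul_le_mul_of_nonneg_left (hDM n) (by positivity)
      _ = K * D * (ψ n * ((n : ℝ) ^ (1 + s - ε) * (n : ℝ) ^ ε)) := by ring
      _ = _ := by
          rw [← Real.rpow_add hn0, sub_add_cancel, Real.rpow_add hn0, Real.rpow_one]
          ring
  refine ⟨max (K * 4 ^ (1 + s)) (K * D), hpos, hanti, lt_max_of_lt_right (by positivity),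
    fun n m hn hnm hm => (hC1 n m hn hnm hm).trans ?_, fun n hn => (hC2 n hn).trans ?_⟩
  · exact mul_le_mul_of_nonneg_right (le_max_left _ _) (hpos m (hn.trans hnm)).le
  · have hψn := hpos n hn
    exact mul_le_mul_of_nonneg_right (le_max_right _ _) (by positivity)

/-- Sequences of bounded oscillation on dyadic blocks. -/
structure DyadicRegular (h : ℕ → ℝ) (C : ℝ) : Prop where
  nonneg : ∀ k, 1 ≤ k → 0 ≤ h k
  const_pos : 0 < C
  le_mul : ∀ n m, 1 ≤ n → n ≤ m → m ≤ 4 * n → h n ≤ C * h m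
  mul_le : ∀ n m, 1 ≤ n → n ≤ m → m ≤ 4 * n → h m ≤ C * h n

theorem DyadicRegular.mul_le_sum {h : ℕ → ℝ} {C : ℝ} (hh : DyadicRegular h C) {n : ℕ} (hn : 1 ≤ n)
    {N : ℕ} (hN : 2 * n ≤ N) : n * h n ≤ C * ∑ k ∈ Ico n N, h k := by
  calc (n : ℝ) * h n = ∑ _k ∈ Ico n (2 * n), h n := by
        rw [sum_const, Nat.card_Ico, nsmul_eq_mul, two_mul, Nat.add_sub_cancel]
    _ ≤ ∑ k ∈ Ico n (2 * n), C * h k := sum_le_sum fun k hk => by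
        obtain ⟨h1, h2⟩ := mem_Ico.mp hk
        exact hh.le_mul n k hn h1 (by lia)
    _ = C * ∑ k ∈ Ico n (2 * n), h k := (mul_sum _ _ _).symm
    _ ≤ _ := mul_le_mul_of_nonneg_left (sum_le_sum_of_subset_of_nonneg
        (Ico_subset_Ico_right hN) fun k hk _ => hh.nonneg k (hn.trans (mem_Ico.mp hk).1))
        hh.const_pos.le

/-- The block `[n, 2n)` is comparable with `[2n, 4n)`, whence the requirement `4n ≤ N`. This
recovers the terms below `2n` that the de la Vallée Poussin argument loses. -/
theorem DyadicRegular.sum_le_sum_two_mul {h : ℕ → ℝ} {C : ℝ} (hh : DyadicRegular h C) {n : ℕ}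
    (hn : 1 ≤ n) {N : ℕ} (hN : 4 * n ≤ N) :
    ∑ k ∈ Ico n N, h k ≤ (C ^ 3 + 1) * ∑ k ∈ Ico (2 * n) N, h k := by
  have hC := hh.const_pos
  have h1 : ∑ k ∈ Ico n (2 * n), h k ≤ C * (n * h n) := by
    calc _ ≤ ∑ _k ∈ Ico n (2 * n), C * h n := sum_le_sum fun k hk => by
          obtain ⟨h1, h2⟩ := mem_Ico.mp hk
          exact hh.mul_le n k hn h1 (by lia)
      _ = _ := by
          rw [sum_const, Nat.card_Ico, nsmul_eq_mul, two_mul, Nat.add_sub_cancel]; ring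
  have h2 := hh.le_mul n (2 * n) hn (by lia) (by lia)
  have h3 := hh.mul_le_sum (n := 2 * n) (by lia) (N := N) (by lia)
  have h4 := hh.nonneg (2 * n) (by lia)
  have hn0 : (0 : ℝ) < n := by exact_mod_cast hn
  push_cast at h3
  have h5 : n * h n ≤ C * (C * ∑ k ∈ Ico (2 * n) N, h k) := by
    calc n * h n ≤ n * (C * h (2 * n)) := by gcongr
      _ ≤ C * (2 * n * h (2 * n)) := by nlinarith [mul_nonneg hC.le (mul_nonneg hn0.le h4)]
      _ ≤ _ := by gcongr
  rw [← sum_Ico_consecutive _ (by lia : n ≤ 2 * n) (by lia : 2 * n ≤ N)]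
  have h6 := mul_le_mul_of_nonneg_left h5 hC.le
  have e : C * (C * (C * ∑ k ∈ Ico (2 * n) N, h k)) = C ^ 3 * ∑ k ∈ Ico (2 * n) N, h k := by ring
  linarith

/-! ### Tail sums, tapered coefficients and the reduction to two kernels -/

theorem tendsto_sum_Ico_tsum {h : ℕ → ℝ} (hs : Summable fun k => h (k + 1)) (n : ℕ) :
    Tendsto (fun N => ∑ k ∈ Ico n N, h k) atTop (𝓝 (∑' j, h (n + j))) := by
  have hs' : Summable h := (summable_nat_add_iff 1).mp hs
  have hsn : Summable fun j => h (n + j) := by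
    simpa only [add_comm] using (summable_nat_add_iff n).mpr hs'
  simp_rw [sum_Ico_eq_sum_range]
  exact hsn.hasSum.tendsto_sum_nat.comp (tendsto_sub_atTop_nat n)

theorem sum_Ico_le_tsum {h : ℕ → ℝ} (hs : Summable fun k => h (k + 1))
    (h0 : ∀ k, 1 ≤ k → 0 ≤ h k) {n : ℕ} (hn : 1 ≤ n) (N : ℕ) :
    ∑ k ∈ Ico n N, h k ≤ ∑' j, h (n + j) := by
  refine ge_of_tendsto (tendsto_sum_Ico_tsum hs n) ((eventually_ge_atTop N).mono fun M hM => ?_)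
  exact sum_le_sum_of_subset_of_nonneg (Ico_subset_Ico_right hM)
    fun k hk _ => h0 k (hn.trans (mem_Ico.mp hk).1)

/-- The factors `(1 - k / N)₊`. -/
noncomputable def taper (N k : ℕ) : ℝ := max 0 (1 - (k : ℝ) / N)

theorem taper_nonneg (N k : ℕ) : 0 ≤ taper N k := le_max_left _ _

theorem taper_le_one (N k : ℕ) : taper N k ≤ 1 :=
  max_le zero_le_one (sub_le_self _ (by positivity))

theorem taper_antitone (N : ℕ) : Antitone (taper N) := by
  intro j k hjk
  unfold taper
  gcongr

theorem taper_eq {N k : ℕ} (h : k < N) : taper N k = 1 - (k : ℝ) / N := by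
  refine max_eq_right (sub_nonneg.mpr (div_le_one_of_le₀ ?_ (by positivity)))
  exact_mod_cast h.le

/-- The factors `1/π` and `1 - n/N` are at most one and are dropped; what remains is one bound for
the low kernel and one for the tapered tail, uniform in `N`. -/
theorem abs_sub_fejerSum_le_of_convHarmonic {ψ : ℝ → ℝ} (hψ : ∀ k : ℕ, 1 ≤ k → 0 < ψ k) {β : ℝ}
    {f φ : ℝ → ℝ} (hf : Continuous f) (hfp : Function.Periodic f (2 * Real.pi))
    (hd : IsPsiBetaDerivative ψ β f φ) {n : ℕ} (hn : 1 ≤ n) {x L T : ℝ}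
    (hL : |∑ k ∈ Ico 1 n, (k * ψ k) * convHarmonic φ (β * Real.pi / 2) x k| ≤ n * L)
    (hT : ∀ N, |∑ k ∈ Ico n N, (taper N k * ψ k) * convHarmonic φ (β * Real.pi / 2) x k| ≤ T) :
    |f x - fejerSum n f x| ≤ L + T := by
  have hn0 : (0 : ℝ) < n := by exact_mod_cast hn
  refine abs_sub_fejerSum_le hf hfp fun N hN => ?_
  have hN0 : (0 : ℝ) < N := by exact_mod_cast hn.trans hN
  have hπ : 0 < 1 / Real.pi := one_div_pos.mpr Real.pi_pos
  have hπ1 : 1 / Real.pi ≤ 1 := by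
    rw [div_le_one Real.pi_pos]
    linarith [Real.pi_gt_three]
  have hnN : 0 ≤ (n : ℝ) / N ∧ (n : ℝ) / N ≤ 1 :=
    ⟨by positivity, div_le_one_of_le₀ (by exact_mod_cast hN) hN0.le⟩
  have e1 : ∑ k ∈ Ico 1 n, (k : ℝ) *
      (fourierCos f k * Real.cos (k * x) + fourierSin f k * Real.sin (k * x))
      = 1 / Real.pi * ∑ k ∈ Ico 1 n, (k * ψ k) * convHarmonic φ (β * Real.pi / 2) x k := by
    rw [mul_sum]
    refine sum_congr rfl fun k hk => ?_
    have hk1 := (mem_Ico.mp hk).1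
    rw [hd.harmonic_eq hk1 (hψ k hk1)]
    ring
  have e2 : ∑ k ∈ Ico n N, (1 - (k : ℝ) / N) *
      (fourierCos f k * Real.cos (k * x) + fourierSin f k * Real.sin (k * x))
      = 1 / Real.pi * ∑ k ∈ Ico n N,
        (taper N k * ψ k) * convHarmonic φ (β * Real.pi / 2) x k := by
    rw [mul_sum]
    refine sum_congr rfl fun k hk => ?_
    have hk1 := hn.trans (mem_Ico.mp hk).1
    rw [hd.harmonic_eq hk1 (hψ k hk1), taper_eq (mem_Ico.mp hk).2]
    ring
  rw [fejerSum_sub_fejerSum f hn hN, e1, e2]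
  refine (abs_add_le _ _).trans (add_le_add ?_ ?_)
  · rw [abs_mul, abs_mul, abs_mul, abs_of_nonneg (by linarith [hnN.2] : 0 ≤ 1 - (n : ℝ) / N),
      abs_of_pos (one_div_pos.mpr hn0), abs_of_pos hπ]
    calc (1 - (n : ℝ) / N) * (1 / n) * (1 / Real.pi * _) ≤ 1 * (1 / n) * (1 * (n * L)) := by
          gcongr
          linarith [hnN.1]
      _ = L := by field_simp
  · rw [abs_mul, abs_of_pos hπ]
    exact (mul_le_of_le_one_left (abs_nonneg _) hπ1).trans (hT N)

theorem periodNorm_le_one {r : ℝ} (hr : 0 < r) {Q : ℝ → ℝ} (hQ : Continuous Q)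
    (h : ∫ t in (0 : ℝ)..(2 * Real.pi), |Q t| ^ r ≤ 1) : periodNorm r Q ≤ 1 := by
  unfold periodNorm
  rw [MemLp.eLpNorm_eq_integral_rpow_norm (by simpa using hr) ENNReal.ofReal_ne_top
    (Continuous.memLp_period hQ _), ENNReal.toReal_ofReal hr.le, ENNReal.ofReal_le_one]
  rw [intervalIntegral.integral_of_le Real.two_pi_pos.le] at h
  exact Real.rpow_le_one (integral_nonneg fun t => Real.rpow_nonneg (norm_nonneg _) _) h
    (inv_nonneg.mpr hr.le)

theorem RegularWeight.dyadicRegular {u : ℕ → ℝ} {s C : ℝ} (h : RegularWeight u s C) (hs : 0 ≤ s) :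
    DyadicRegular u (max C 1) where
  nonneg k hk := (h.pos k hk).le
  const_pos := lt_max_of_lt_left h.const_pos
  le_mul n _ hn hnm hm := (h.doubling n _ hn hnm hm).trans
    (mul_le_mul_of_nonneg_right (le_max_left _ _) (h.pos _ (hn.trans hnm)).le)
  mul_le n _ hn hnm _ := (h.le_of_le hs hn hnm).trans
    (le_mul_of_one_le_left (h.pos n hn).le (le_max_right _ _))

/-- The sign of `q - 2` is not known, so `k^q` and `k^{-2}` are compared separately: `16 = 4²` comes
from the latter, `C^q` from doubling, and `4^q` from the growth of `k^q`. -/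
theorem RegularWeight.dyadicRegular_rpow {u : ℕ → ℝ} {s C : ℝ} (h : RegularWeight u s C)
    (hs : 0 ≤ s) {q : ℝ} (hq : 0 ≤ q) :
    DyadicRegular (fun k => u k ^ q * (k : ℝ) ^ (q - 2)) (16 * C ^ q + 4 ^ q) where
  nonneg k hk := mul_nonneg (Real.rpow_nonneg (h.pos k hk).le q) (by positivity)
  const_pos := by have := h.const_pos; positivity
  le_mul n m hn hnm hm := by
    have hC := h.const_pos
    have hn0 : (0 : ℝ) < n := by exact_mod_cast hn
    have hnm' : (n : ℝ) ≤ m := by exact_mod_cast hnm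
    have hm' : (m : ℝ) ≤ 4 * n := by exact_mod_cast hm
    have hm0 := hn0.trans_le hnm'
    have hum := h.pos m (hn.trans hnm)
    have h1 : u n ^ q ≤ C ^ q * u m ^ q := by
      rw [← Real.mul_rpow hC.le hum.le]
      exact Real.rpow_le_rpow (h.pos n hn).le (h.doubling n m hn hnm hm) hq
    have h2 : (n : ℝ) ^ (q - 2) ≤ 16 * (m : ℝ) ^ (q - 2) := by
      rw [Real.rpow_sub hn0, Real.rpow_sub hm0, ← mul_div_assoc, Real.rpow_two, Real.rpow_two,
        div_le_div_iff₀ (by positivity) (by positivity)]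
      calc (n : ℝ) ^ q * m ^ 2 ≤ m ^ q * (4 * n) ^ 2 := by gcongr
        _ = _ := by ring
    calc u n ^ q * (n : ℝ) ^ (q - 2) ≤ (C ^ q * u m ^ q) * (16 * (m : ℝ) ^ (q - 2)) := by gcongr
      _ = 16 * C ^ q * (u m ^ q * (m : ℝ) ^ (q - 2)) := by ring
      _ ≤ _ := by
        refine mul_le_mul_of_nonneg_right ?_ (by positivity)
        linarith [Real.rpow_nonneg (by norm_num : (0 : ℝ) ≤ 4) q]
  mul_le n m hn hnm hm := by
    have hC := h.const_pos
    have hn0 : (0 : ℝ) < n := by exact_mod_cast hn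
    have hnm' : (n : ℝ) ≤ m := by exact_mod_cast hnm
    have hm' : (m : ℝ) ≤ 4 * n := by exact_mod_cast hm
    have hm0 := hn0.trans_le hnm'
    have hun := h.pos n hn
    have h1 : u m ^ q ≤ u n ^ q :=
      Real.rpow_le_rpow (h.pos m (hn.trans hnm)).le (h.le_of_le hs hn hnm) hq
    have h2 : (m : ℝ) ^ (q - 2) ≤ 4 ^ q * (n : ℝ) ^ (q - 2) := by
      rw [Real.rpow_sub hn0, Real.rpow_sub hm0, ← mul_div_assoc, Real.rpow_two, Real.rpow_two,
        ← Real.mul_rpow (by norm_num) hn0.le]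
      gcongr
    calc u m ^ q * (m : ℝ) ^ (q - 2) ≤ u n ^ q * (4 ^ q * (n : ℝ) ^ (q - 2)) := by gcongr
      _ = 4 ^ q * (u n ^ q * (n : ℝ) ^ (q - 2)) := by ring
      _ ≤ _ := by
        refine mul_le_mul_of_nonneg_right ?_ (by positivity)
        have : 0 ≤ 16 * C ^ q := by positivity
        linarith

/-- Cutting the Fejér factor off at zero keeps the product non-negative and non-increasing past `N`
as well, as the Abel-type lemmas require. -/
theorem taper_mul_antitone {u : ℕ → ℝ} {s C : ℝ} (h : RegularWeight u s C) (hs : 0 ≤ s) (N : ℕ)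
    {k : ℕ} (hk : 1 ≤ k) : taper N (k + 1) * u (k + 1) ≤ taper N k * u k :=
  mul_le_mul (taper_antitone N k.le_succ) (h.antitone hs k hk) (h.pos _ (by lia)).le
    (taper_nonneg N k)

theorem taper_mul_nonneg {u : ℕ → ℝ} {s C : ℝ} (h : RegularWeight u s C) (N : ℕ)
    {k : ℕ} (hk : 1 ≤ k) : 0 ≤ taper N k * u k :=
  mul_nonneg (taper_nonneg N k) (h.pos k hk).le

theorem taper_mul_le {u : ℕ → ℝ} {s C : ℝ} (h : RegularWeight u s C) (N : ℕ)
    {k : ℕ} (hk : 1 ≤ k) : taper N k * u k ≤ u k :=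
  mul_le_of_le_one_left (h.pos k hk).le (taper_le_one N k)

/-! ### Order estimates for `p > 1` -/

theorem exists_fejerDeviation_le {p q : ℝ} (hpq : p.HolderConjugate q) {ψ : ℝ → ℝ} {β C : ℝ}
    (hw : RegularWeight (fun k => ψ k) (1 / p) C)
    (hs : Summable fun k : ℕ => ψ ((k + 1 : ℕ) : ℝ) ^ q * ((k + 1 : ℕ) : ℝ) ^ (q - 2)) :
    ∃ K : ℝ, 0 < K ∧ ∀ n : ℕ, 1 ≤ n → fejerDeviation (psiBetaClass ψ β p) n ≤ ENNReal.ofReal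
      (K * (∑' j : ℕ, ψ ((n + j : ℕ) : ℝ) ^ q * ((n + j : ℕ) : ℝ) ^ (q - 2)) ^ (1 / q)) := by
  have hp0 : 0 ≤ 1 / p := one_div_nonneg.mpr hpq.nonneg
  have hp1 : 1 / p ≤ 1 := (div_le_one hpq.pos).mpr hpq.lt.le
  have hq0 : 0 < q := hpq.symm.pos
  have hq0' : 0 ≤ 1 / q := one_div_nonneg.mpr hq0.le
  have hC := hw.const_pos
  have hreg := hw.dyadicRegular_rpow hp0 hq0.le
  set h : ℕ → ℝ := fun k => ψ k ^ q * (k : ℝ) ^ (q - 2) with hh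
  set D := 16 * C ^ q + 4 ^ q with hD
  have hD0 : 0 < D := hreg.const_pos
  obtain ⟨B₁, hB₁, hlow⟩ := exists_abs_sum_convHarmonic_le hpq
  obtain ⟨B₂, hB₂, hhigh⟩ := exists_abs_sum_mul_convHarmonic_le hpq
  refine ⟨3 * B₁ * C * D ^ (1 / q) + B₂ * (D + 1) ^ (1 / q), by positivity, fun n hn => ?_⟩
  have hn0 : (0 : ℝ) < n := by exact_mod_cast hn
  have hψn := hw.pos n hn
  set R := ∑' j : ℕ, ψ ((n + j : ℕ) : ℝ) ^ q * ((n + j : ℕ) : ℝ) ^ (q - 2) with hR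
  have hRle : ∀ N, ∑ k ∈ Ico n N, h k ≤ R := sum_Ico_le_tsum (h := h) hs hreg.nonneg hn
  have hR0 : 0 ≤ R := by simpa using hRle 0
  have hnh : n * h n ≤ D * R := (hreg.mul_le_sum hn le_rfl).trans
    (mul_le_mul_of_nonneg_left (hRle _) hD0.le)
  have hnh' : ψ n ^ q * (n : ℝ) ^ (q - 1) = n * h n := by
    rw [hh, show q - 1 = q - 2 + 1 by ring, Real.rpow_add_one hn0.ne']
    ring
  have hnh0 : 0 ≤ n * h n := by rw [← hnh']; positivity
  -- The low-frequency contribution `ψ(n) n^{1/p}` is the `q`-th root of `n h(n)`, which is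
  -- comparable to a single dyadic block of the tail.
  have hψR : ψ n * (n : ℝ) ^ (1 / p) ≤ D ^ (1 / q) * R ^ (1 / q) := by
    have e : ψ n * (n : ℝ) ^ (1 / p) = (n * h n) ^ (1 / q) := by
      rw [← hnh', Real.mul_rpow (by positivity) (by positivity), ← Real.rpow_mul hψn.le,
        ← Real.rpow_mul hn0.le, mul_one_div_cancel hq0.ne', Real.rpow_one]
      congr 2
      have := hpq.inv_add_inv_eq_one
      rw [one_div, one_div, sub_mul, mul_inv_cancel₀ hq0.ne']
      linarith
    rw [e, ← Real.mul_rpow hD0.le hR0]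
    exact Real.rpow_le_rpow hnh0 hnh hq0'
  refine fejerDeviation_le fun f ⟨hf, hfp, φ, hφ, hd⟩ x => ?_
  have hL : |∑ k ∈ Ico 1 n, (k * ψ k) * convHarmonic φ (β * Real.pi / 2) x k|
      ≤ n * (3 * B₁ * C * D ^ (1 / q) * R ^ (1 / q)) := by
    have h1 := abs_sum_nat_mul_le hp0 hp1 (fun k hk => (hw.pos k hk).le) hw.mul_rpow_antitone
      (fun m => hlow φ hφ hd.1 m (β * Real.pi / 2) x) hn
    refine h1.trans ?_
    calc 3 * B₁ * ∑ k ∈ Icc 1 n, ψ k * (k : ℝ) ^ (1 / p)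
        ≤ 3 * B₁ * (C * (n * (D ^ (1 / q) * R ^ (1 / q)))) := by
          refine mul_le_mul_of_nonneg_left ((hw.sum_le n hn).trans ?_) (by positivity)
          gcongr
      _ = _ := by ring
  have hT : ∀ N, |∑ k ∈ Ico n N, (taper N k * ψ k) * convHarmonic φ (β * Real.pi / 2) x k|
      ≤ B₂ * (D + 1) ^ (1 / q) * R ^ (1 / q) := by
    intro N
    refine (hhigh φ hφ hd.1 (fun k => taper N k * ψ k) n N (β * Real.pi / 2) x hn
      (fun k hk => taper_mul_nonneg hw N (hn.trans hk))
      (fun k hk => taper_mul_antitone hw hp0 N (hn.trans hk))).trans ?_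
    have hle : ∀ k, n ≤ k → (taper N k * ψ k) ^ q ≤ ψ k ^ q := fun k hk =>
      Real.rpow_le_rpow (taper_mul_nonneg hw N (hn.trans hk)) (taper_mul_le hw N (hn.trans hk))
        hq0.le
    rw [mul_assoc, ← Real.mul_rpow (by positivity) hR0]
    refine mul_le_mul_of_nonneg_left (Real.rpow_le_rpow ?_ ?_ hq0') hB₂.le
    · exact add_nonneg (mul_nonneg (Real.rpow_nonneg (taper_mul_nonneg hw N hn) _) (by positivity))
        (sum_nonneg fun k hk => mul_nonneg (Real.rpow_nonneg
          (taper_mul_nonneg hw N (hn.trans (mem_Ico.mp hk).1)) _) (by positivity))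
    · have h1 : (taper N n * ψ n) ^ q * (n : ℝ) ^ (q - 1) ≤ D * R :=
        (mul_le_mul_of_nonneg_right (hle n le_rfl) (by positivity)).trans (hnh'.trans_le hnh)
      have h2 : ∑ k ∈ Ico n N, (taper N k * ψ k) ^ q * (k : ℝ) ^ (q - 2) ≤ R :=
        (sum_le_sum fun k hk => mul_le_mul_of_nonneg_right (hle k (mem_Ico.mp hk).1)
          (by positivity)).trans (hRle N)
      linarith
  refine (abs_sub_fejerSum_le_of_convHarmonic hw.pos hf hfp hd hn hL hT).trans_eq ?_
  ring

theorem ofReal_tsum_rpow_le {h : ℕ → ℝ} (hs : Summable fun k => h (k + 1)) {n : ℕ} {r : ℝ}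
    (hr : 0 ≤ r) {E : ℝ≥0∞} {M : ℕ}
    (hE : ∀ N, M ≤ N → ENNReal.ofReal ((∑ k ∈ Ico n N, h k) ^ r) ≤ E) :
    ENNReal.ofReal ((∑' j, h (n + j)) ^ r) ≤ E := by
  have h1 := ((tendsto_sum_Ico_tsum hs n).rpow_const (Or.inr hr) : Tendsto _ _ (𝓝 _))
  exact le_of_tendsto (ENNReal.tendsto_ofReal h1) ((eventually_ge_atTop M).mono hE)

theorem exists_le_bestApprox {p q : ℝ} (hpq : p.HolderConjugate q) {ψ : ℝ → ℝ} {β C : ℝ}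
    (hw : RegularWeight (fun k => ψ k) (1 / p) C)
    (hs : Summable fun k : ℕ => ψ ((k + 1 : ℕ) : ℝ) ^ q * ((k + 1 : ℕ) : ℝ) ^ (q - 2)) :
    ∃ K : ℝ, 0 < K ∧ ∀ n : ℕ, 1 ≤ n →
      ENNReal.ofReal
        ((∑' j : ℕ, ψ ((n + j : ℕ) : ℝ) ^ q * ((n + j : ℕ) : ℝ) ^ (q - 2)) ^ (1 / q))
      ≤ ENNReal.ofReal K * bestApprox (psiBetaClass ψ β p) n := by
  have hp0 : 0 ≤ 1 / p := one_div_nonneg.mpr hpq.nonneg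
  have hp : 0 < p := hpq.pos
  have hq0 : 0 < q := hpq.symm.pos
  have hq1 : 0 < q - 1 := by linarith [hpq.symm.lt]
  have hq0' : 0 ≤ 1 / q := one_div_nonneg.mpr hq0.le
  have hpqs : (q - 1) * p = q := by
    have := hpq.symm.sub_one_mul_conj
    linarith
  have hsum : 1 / p + 1 / q = 1 := by
    have := hpq.inv_add_inv_eq_one
    rw [one_div, one_div]; exact this
  have hC := hw.const_pos
  have hreg := hw.dyadicRegular_rpow hp0 hq0.le
  set h : ℕ → ℝ := fun k => ψ k ^ q * (k : ℝ) ^ (q - 2) with hh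
  set D := 16 * C ^ q + 4 ^ q with hD
  have hD0 : 0 < D := hreg.const_pos
  obtain ⟨B, hB, hHL⟩ := exists_integral_abs_sum_cos_rpow_le hpq.lt
  -- Equality case of the weighted Hölder inequality: both `ψ c` and `c^p k^{p-2}` equal the summand
  -- `ψ^q k^{q-2}`.
  set c : ℕ → ℝ := fun k => ψ k ^ (q - 1) * (k : ℝ) ^ (q - 2) with hc
  have hc0 : ∀ k, 1 ≤ k → 0 ≤ c k := fun k hk =>
    mul_nonneg (Real.rpow_nonneg (hw.pos k hk).le _) (by positivity)
  have hcanti : ∀ k, 1 ≤ k → c (k + 1) ≤ c k := by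
    intro k hk
    -- In this form `c` is a product of two non-increasing factors, so Hardy–Littlewood applies to
    -- it.
    have e : ∀ k, 1 ≤ k → c k
        = (ψ k * (k : ℝ) ^ (1 / p)) ^ (q - 1) * (k : ℝ) ^ (-(1 / q)) := by
      intro k hk
      have hk0 : (0 : ℝ) < k := by exact_mod_cast hk
      rw [Real.mul_rpow (hw.pos k hk).le (by positivity), ← Real.rpow_mul hk0.le, mul_assoc,
        ← Real.rpow_add hk0]
      have hpe : 1 / p = 1 - 1 / q := by linarith
      have he : 1 / p * (q - 1) + -(1 / q) = q - 2 := by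
        rw [hpe]
        field_simp
        ring
      rw [he]
    have hk0 : (0 : ℝ) < k := by exact_mod_cast hk
    rw [e k hk, e (k + 1) (by lia)]
    refine mul_le_mul (Real.rpow_le_rpow (mul_nonneg (hw.pos _ (by lia)).le (by positivity))
      (hw.mul_rpow_antitone k hk) hq1.le) ?_ (by positivity)
      (Real.rpow_nonneg (mul_nonneg (hw.pos k hk).le (by positivity)) _)
    exact Real.rpow_le_rpow_of_nonpos hk0 (by push_cast; linarith) (by linarith)
  have hcp : ∀ k : ℕ, 1 ≤ k → c k ^ p * (k : ℝ) ^ (p - 2) = h k := by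
    intro k hk
    have hk0 : (0 : ℝ) < k := by exact_mod_cast hk
    have hψk := (hw.pos k hk).le
    simp only [hc, hh]
    rw [Real.mul_rpow (by positivity) (by positivity), ← Real.rpow_mul hψk, ← Real.rpow_mul hk0.le,
      hpqs, mul_assoc, ← Real.rpow_add hk0]
    congr 2
    linear_combination hpqs
  have hψc : ∀ k : ℕ, 1 ≤ k → ψ k * c k = h k := by
    intro k hk
    simp only [hc, hh]
    rw [← mul_assoc, ← Real.rpow_one_add' (hw.pos k hk).le (by linarith), add_sub_cancel]
  set A := (B * (D + 1)) ^ (1 / p) with hA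
  have hA0 : 0 < A := by positivity
  refine ⟨(D ^ 3 + 1) ^ (1 / q) * (A * 4), by positivity, fun n hn => ?_⟩
  have hn0 : (0 : ℝ) < n := by exact_mod_cast hn
  refine ofReal_tsum_rpow_le (h := h) hs hq0' (M := 4 * n) fun N hN => ?_
  set S := ∑ k ∈ Ico (2 * n) N, h k with hS
  have hhpos : ∀ k, 1 ≤ k → 0 < h k := fun k hk =>
    mul_pos (Real.rpow_pos_of_pos (hw.pos k hk) _)
      (Real.rpow_pos_of_pos (by exact_mod_cast hk) _)
  have hS0 : 0 < S := sum_pos (fun k hk => hhpos k (by have := (mem_Ico.mp hk).1; lia))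
    ⟨2 * n, mem_Ico.mpr ⟨le_rfl, by lia⟩⟩
  -- `W` bounds the `L_p` norm of the unnormalized sum: its Hardy–Littlewood bound is `B` times the
  -- sum `S` plus the boundary term, itself at most `D S`.
  set W := A * S ^ (1 / p) with hW
  have hW0 : 0 < W := by positivity
  set w : ℕ → ℝ := fun k => if 2 * n ≤ k then c k / W else 0 with hwdef
  have hpoly : ∀ t, phasePoly 0 w (fun _ => -(β * Real.pi / 2)) N t
      = W⁻¹ * ∑ k ∈ Ico (2 * n) N, c k * Real.cos (k * t - -(β * Real.pi / 2)) := by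
    intro t
    unfold phasePoly
    rw [zero_add, ← sum_Ico_consecutive _ (by lia : 1 ≤ 2 * n) (by lia : 2 * n ≤ N), sum_eq_zero,
      zero_add, mul_sum]
    · refine sum_congr rfl fun k hk => ?_
      rw [hwdef]
      simp only
      rw [if_pos (mem_Ico.mp hk).1]
      ring
    · intro k hk
      rw [hwdef]
      simp only
      rw [if_neg (by have := (mem_Ico.mp hk).2; lia), zero_mul]
  have hnorm : periodNorm p (phasePoly 0 w (fun _ => -(β * Real.pi / 2)) N) ≤ 1 := by
    refine periodNorm_le_one hp (continuous_phasePoly _ _ _ _) ?_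
    simp_rw [hpoly, abs_mul, abs_of_pos (inv_pos.mpr hW0),
      Real.mul_rpow (inv_nonneg.mpr hW0.le) (abs_nonneg _)]
    rw [intervalIntegral.integral_const_mul]
    have h1 := hHL c (2 * n) N (-(β * Real.pi / 2)) (by lia) (fun k hk => hc0 k (by lia))
      (fun k hk => hcanti k (by lia))
    have h2 : ∑ k ∈ Ico (2 * n) N, c k ^ p * (k : ℝ) ^ (p - 2) = S :=
      sum_congr rfl fun k hk => hcp k (by have := (mem_Ico.mp hk).1; lia)
    have h3 : c (2 * n) ^ p * ((2 * n : ℕ) : ℝ) ^ (p - 1) ≤ D * S := by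
      have h2n : ((2 * n : ℕ) : ℝ) ≠ 0 := by push_cast; positivity
      rw [show p - 1 = p - 2 + 1 by ring, Real.rpow_add_one h2n, ← mul_assoc, hcp _ (by lia),
        mul_comm]
      exact hreg.mul_le_sum (by lia) (by lia)
    rw [h2] at h1
    have h4 : W ^ p = B * (D + 1) * S := by
      rw [hW, hA, ← Real.mul_rpow (by positivity) hS0.le, ← Real.rpow_mul (by positivity),
        one_div_mul_cancel hp.ne', Real.rpow_one]
    rw [Real.inv_rpow hW0.le, inv_mul_le_iff₀ (by positivity), mul_one, h4]
    refine h1.trans ?_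
    nlinarith
  have hcos : ∀ k : ℕ, ψ k * w k * Real.cos (-(β * Real.pi / 2) + β * Real.pi / 2) = ψ k * w k :=
    fun k => by rw [neg_add_cancel, Real.cos_zero, mul_one]
  have hmain := ofReal_sum_le_bestApprox (β := β) hw.pos hn hnorm fun k hk => by
    rw [hcos]
    refine mul_nonneg (hw.pos k (mem_Ico.mp hk).1).le ?_
    simp only [hwdef]
    split_ifs
    · exact div_nonneg (hc0 k (mem_Ico.mp hk).1) hW0.le
    · exact le_rfl
  -- The phase `-βπ/2` of the derivative cancels that of the class, so all cosines at the origin are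
  -- one and the sum is `S/W`.
  have hval : ∑ k ∈ Ico (2 * n) N, ψ k * w k * Real.cos (-(β * Real.pi / 2) + β * Real.pi / 2)
      = S ^ (1 / q) / A := by
    have e : S / W = S ^ (1 / q) / A := by
      rw [hW, div_eq_div_iff (by positivity) hA0.ne']
      have : S ^ (1 / q) * S ^ (1 / p) = S := by
        rw [← Real.rpow_add hS0, add_comm, hsum, Real.rpow_one]
      linear_combination (-A) * this
    rw [← e, hS, sum_div]
    refine sum_congr rfl fun k hk => ?_
    have hk := (mem_Ico.mp hk).1
    have hwk : w k = c k / W := if_pos hk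
    rw [hcos, ← hψc k (by lia), hwk]
    exact (mul_div_assoc _ _ _).symm
  rw [hval] at hmain
  have hle : (∑ k ∈ Ico n N, h k) ^ (1 / q)
      ≤ (D ^ 3 + 1) ^ (1 / q) * A * (S ^ (1 / q) / A) := by
    have h1 := Real.rpow_le_rpow (sum_nonneg fun k hk => (hhpos k (hn.trans
      (mem_Ico.mp hk).1)).le) (hreg.sum_le_sum_two_mul hn hN) hq0'
    rw [Real.mul_rpow (by positivity) hS0.le] at h1
    refine h1.trans_eq ?_
    field_simp
  refine (ENNReal.ofReal_le_ofReal hle).trans ?_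
  rw [ENNReal.ofReal_mul (by positivity)]
  refine (mul_le_mul_right hmain _).trans_eq ?_
  rw [← mul_assoc, ← ENNReal.ofReal_mul (by positivity), mul_assoc]

/-! ### Order estimates for `p = 1` -/

/-- Against the unit ball of `L_1` only the supremum of the kernel matters. The low kernel is
bounded trivially by `∑ k ψ(k) = O(n · nψ(n))`, so `β` matters only for the tail, which is left as
an assumption. -/
theorem exists_fejerDeviation_one_le {ψ : ℝ → ℝ} {β C : ℝ} {R : ℕ → ℝ}
    (hw : RegularWeight (fun k => ψ k) 1 C)
    (hR : ∃ D, 0 < D ∧ ∀ n : ℕ, 1 ≤ n → n * ψ n ≤ D * R n)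
    (htail : ∃ D, 0 < D ∧ ∀ n N : ℕ, 1 ≤ n → ∀ u : ℝ,
      |∑ k ∈ Ico n N, taper N k * ψ k * Real.cos (k * u - β * Real.pi / 2)| ≤ D * R n) :
    ∃ K : ℝ, 0 < K ∧ ∀ n : ℕ, 1 ≤ n →
      fejerDeviation (psiBetaClass ψ β 1) n ≤ ENNReal.ofReal (K * R n) := by
  obtain ⟨D₁, hD₁, hR⟩ := hR
  obtain ⟨D₂, hD₂, htail⟩ := htail
  have hC := hw.const_pos
  refine ⟨C * D₁ + D₂, by positivity, fun n hn => ?_⟩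
  have hn0 : (0 : ℝ) < n := by exact_mod_cast hn
  refine fejerDeviation_le fun f ⟨hf, hfp, φ, hφ, hd⟩ x => ?_
  rw [add_mul]
  refine abs_sub_fejerSum_le_of_convHarmonic hw.pos hf hfp hd hn ?_ fun N => ?_
  · rw [sum_mul_convHarmonic hd.1]
    refine abs_integral_mul_le_of_unitBall_one
      (Q := fun u => ∑ k ∈ Ico 1 n, k * ψ k * Real.cos (k * u - β * Real.pi / 2)) hφ
      (fun u => ?_) x
    calc _ ≤ ∑ k ∈ Ico 1 n, ψ k * (k : ℝ) ^ (1 : ℝ) := by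
          refine (abs_sum_le_sum_abs _ _).trans (sum_le_sum fun k hk => ?_)
          have hk := hw.pos k (mem_Ico.mp hk).1
          rw [abs_mul, abs_of_nonneg (by positivity), Real.rpow_one, mul_comm (ψ k)]
          exact mul_le_of_le_one_right (by positivity) (Real.abs_cos_le_one _)
      _ ≤ ∑ k ∈ Icc 1 n, ψ k * (k : ℝ) ^ (1 : ℝ) :=
          sum_le_sum_of_subset_of_nonneg (fun k hk => by
            rw [mem_Ico] at hk
            rw [mem_Icc]
            exact ⟨hk.1, hk.2.le⟩) fun k hk _ =>
              mul_nonneg (hw.pos k (mem_Icc.mp hk).1).le (by positivity)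
      _ ≤ C * (n * (ψ n * (n : ℝ) ^ (1 : ℝ))) := hw.sum_le n hn
      _ = C * (n * (n * ψ n)) := by rw [Real.rpow_one]; ring
      _ ≤ C * (n * (D₁ * R n)) := mul_le_mul_of_nonneg_left
          (mul_le_mul_of_nonneg_left (hR n hn) hn0.le) hC.le
      _ = _ := by ring
  · rw [sum_mul_convHarmonic hd.1]
    exact abs_integral_mul_le_of_unitBall_one
      (Q := fun u => ∑ k ∈ Ico n N, taper N k * ψ k * Real.cos (k * u - β * Real.pi / 2)) hφ
      (fun u => htail n N hn u) x

/-- The extremal derivative in `L_1`: a translate of the centred Fejér kernel. -/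
theorem periodNorm_centred_fejerKernel_le {σ : ℝ} (hσ : |σ| = 1) (y : ℝ) {N : ℕ} (hN : 1 ≤ N) :
    periodNorm 1 (phasePoly 0 (fun k => σ / (2 * Real.pi) * (1 - (k : ℝ) / N))
      (fun k => k * y) N) ≤ 1 := by
  have hπ := Real.pi_pos
  refine periodNorm_le_one one_pos (continuous_phasePoly _ _ _ _) ?_
  have hFc : Continuous fun t => fejerKernel N (t - y) :=
    (continuous_fejerKernel N).comp (by fun_prop)
  have hpt : ∀ t, phasePoly 0 (fun k => σ / (2 * Real.pi) * (1 - (k : ℝ) / N))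
      (fun k => k * y) N t = σ / (4 * Real.pi) * (fejerKernel N (t - y) - 1) := by
    intro t
    unfold phasePoly fejerKernel
    rw [zero_add, add_sub_cancel_left, mul_sum, mul_sum]
    refine sum_congr rfl fun k _ => ?_
    rw [mul_sub]
    field_simp
    ring
  have hint : ∫ t in (0 : ℝ)..(2 * Real.pi), fejerKernel N (t - y) = 2 * Real.pi := by
    rw [intervalIntegral.integral_comp_sub_right, zero_sub]
    have := (fejerKernel_periodic N).intervalIntegral_add_eq (-y) 0
    rwa [zero_add, neg_add_eq_sub, integral_fejerKernel] at this
  simp_rw [hpt, Real.rpow_one, abs_mul, abs_div, hσ, abs_of_pos (by positivity : 0 < 4 * Real.pi)]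
  rw [intervalIntegral.integral_const_mul]
  -- Positivity gives `|F - 1| ≤ F + 1`, with integral `4π`, which the factor `1/(4π)` compensates.
  have hle : ∫ t in (0 : ℝ)..(2 * Real.pi), |fejerKernel N (t - y) - 1|
      ≤ ∫ t in (0 : ℝ)..(2 * Real.pi), (fejerKernel N (t - y) + 1) := by
    refine intervalIntegral.integral_mono_on Real.two_pi_pos.le
      (Continuous.intervalIntegrable (by fun_prop) _ _)
      (Continuous.intervalIntegrable (by fun_prop) _ _) fun t _ => ?_
    have := fejerKernel_nonneg hN (t - y)
    rw [abs_le]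
    constructor <;> linarith
  rw [intervalIntegral.integral_add (hFc.intervalIntegrable _ _) (by simp), hint,
    intervalIntegral.integral_const, sub_zero, smul_eq_mul, mul_one] at hle
  rw [one_div, inv_mul_le_iff₀ (by positivity)]
  linarith

/-- The free parameters are the sign `σ` and the translation `y` of the kernel, chosen to make the
harmonics non-negative at the origin; `κ` measures how large they are on the block that is kept. -/
theorem ofReal_mul_sum_le_bestApprox_one {ψ : ℝ → ℝ} (hψ : ∀ k : ℕ, 1 ≤ k → 0 < ψ k) {β σ y κ : ℝ}
    (hσ : |σ| = 1) {n M N : ℕ} (hn : 1 ≤ n) (hMN : M ≤ N) (hN : 1 ≤ N)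
    (hpos : ∀ k ∈ Ico 1 N, 0 ≤ σ * Real.cos (k * y + β * Real.pi / 2))
    (hκM : ∀ k ∈ Ico (2 * n) M,
      κ ≤ (1 - (k : ℝ) / N) * (σ * Real.cos (k * y + β * Real.pi / 2))) :
    ENNReal.ofReal (κ / (2 * Real.pi) * ∑ k ∈ Ico (2 * n) M, ψ k)
      ≤ ENNReal.ofReal 4 * bestApprox (psiBetaClass ψ β 1) n := by
  have hπ := Real.pi_pos
  have hform : ∀ k : ℕ, ψ k * (σ / (2 * Real.pi) * (1 - (k : ℝ) / N))
      * Real.cos (k * y + β * Real.pi / 2) = ψ k / (2 * Real.pi) *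
        ((1 - (k : ℝ) / N) * (σ * Real.cos (k * y + β * Real.pi / 2))) := fun k => by ring
  have hnn : ∀ k ∈ Ico 1 N, 0 ≤ ψ k * (σ / (2 * Real.pi) * (1 - (k : ℝ) / N))
      * Real.cos (k * y + β * Real.pi / 2) := by
    intro k hk
    have hψk := hψ k (mem_Ico.mp hk).1
    rw [hform, ← taper_eq (mem_Ico.mp hk).2]
    exact mul_nonneg (by positivity) (mul_nonneg (taper_nonneg _ _) (hpos k hk))
  refine le_trans (ENNReal.ofReal_le_ofReal ?_) (ofReal_sum_le_bestApprox hψ hn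
    (periodNorm_centred_fejerKernel_le hσ y hN) hnn)
  rw [mul_sum]
  refine le_trans (sum_le_sum fun k hk => ?_) (sum_le_sum_of_subset_of_nonneg
    (Ico_subset_Ico_right hMN) fun k hk _ => hnn k (Ico_subset_Ico_left (by lia) hk))
  have hψk := hψ k (by have := (mem_Ico.mp hk).1; lia)
  rw [hform]
  calc κ / (2 * Real.pi) * ψ k = ψ k / (2 * Real.pi) * κ := by ring
    _ ≤ _ := mul_le_mul_of_nonneg_left (hκM k hk) (by positivity)

theorem exists_le_bestApprox_one_of_cos_ne_zero {ψ : ℝ → ℝ} {β C : ℝ}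
    (hw : RegularWeight (fun k => ψ k) 1 C)
    (hs : Summable fun k : ℕ => ψ ((k + 1 : ℕ) : ℝ)) (hcos : Real.cos (β * Real.pi / 2) ≠ 0) :
    ∃ K : ℝ, 0 < K ∧ ∀ n : ℕ, 1 ≤ n → ENNReal.ofReal (∑' j : ℕ, ψ ((n + j : ℕ) : ℝ))
      ≤ ENNReal.ofReal K * bestApprox (psiBetaClass ψ β 1) n := by
  have hπ := Real.pi_pos
  have hreg := hw.dyadicRegular zero_le_one
  set D := max C 1
  have hD := hreg.const_pos
  set δ := |Real.cos (β * Real.pi / 2)| with hδ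
  have hδ0 : 0 < δ := abs_pos.mpr hcos
  obtain ⟨σ, hσ, hσc⟩ : ∃ σ : ℝ, |σ| = 1 ∧ σ * Real.cos (β * Real.pi / 2) = δ := by
    rcases abs_choice (Real.cos (β * Real.pi / 2)) with h | h
    · exact ⟨1, abs_one, by rw [hδ, h, one_mul]⟩
    · exact ⟨-1, by simp, by rw [hδ, h, neg_one_mul]⟩
  refine ⟨(D ^ 3 + 1) * (4 * Real.pi / δ) * 4, by positivity, fun n hn => ?_⟩
  have key := ofReal_tsum_rpow_le (h := fun k : ℕ => ψ k) hs (n := n) zero_le_one (M := 4 * n)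
    (E := ENNReal.ofReal ((D ^ 3 + 1) * (4 * Real.pi / δ) * 4)
      * bestApprox (psiBetaClass ψ β 1) n) fun N hN => ?_
  · simpa only [Real.rpow_one] using key
  · rw [Real.rpow_one]
    -- No translation is needed, since all harmonics have the sign of `cos(βπ/2)`. A kernel with
    -- parameter `2N` has Fejér factors at least `1/2` for `k < N`, hence `κ = δ/2`.
    have h1 := ofReal_mul_sum_le_bestApprox_one (β := β) (y := 0) (κ := δ / 2) (M := N)
      (N := 2 * N) hw.pos hσ hn (by lia) (by lia)
      (fun k _ => by rw [mul_zero, zero_add, hσc]; exact hδ0.le) fun k hk => by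
        rw [mul_zero, zero_add, hσc]
        have hN0 : (0 : ℝ) < N := by
          have : 1 ≤ N := by lia
          exact_mod_cast this
        have hk : (k : ℝ) ≤ N := by exact_mod_cast (mem_Ico.mp hk).2.le
        have : (k : ℝ) / ((2 * N : ℕ) : ℝ) ≤ 1 / 2 := by
          push_cast
          rw [div_le_div_iff₀ (by positivity) two_pos]
          linarith
        nlinarith
    refine (ENNReal.ofReal_le_ofReal ((hreg.sum_le_sum_two_mul hn hN).trans_eq
      (?_ : _ = (D ^ 3 + 1) * (4 * Real.pi / δ)
        * (δ / 2 / (2 * Real.pi) * ∑ k ∈ Ico (2 * n) N, ψ k)))).trans ?_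
    · field_simp
      ring
    · rw [ENNReal.ofReal_mul (by positivity)]
      refine (mul_le_mul_right h1 _).trans_eq ?_
      rw [← mul_assoc, ← ENNReal.ofReal_mul (by positivity)]

theorem exists_le_bestApprox_one_of_cos_eq_zero {ψ : ℝ → ℝ} {β C : ℝ}
    (hw : RegularWeight (fun k => ψ k) 1 C) (hcos : Real.cos (β * Real.pi / 2) = 0) :
    ∃ K : ℝ, 0 < K ∧ ∀ n : ℕ, 1 ≤ n → ENNReal.ofReal (ψ n * n)
      ≤ ENNReal.ofReal K * bestApprox (psiBetaClass ψ β 1) n := by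
  have hπ := Real.pi_pos
  have hC := hw.const_pos
  set σ := -Real.sin (β * Real.pi / 2) with hσdef
  have hσ2 : σ ^ 2 = 1 := by
    have := Real.sin_sq_add_cos_sq (β * Real.pi / 2)
    rw [hcos] at this
    rw [hσdef]; linarith
  have hσ : |σ| = 1 := by
    rw [← sq_eq_sq₀ (abs_nonneg σ) zero_le_one, sq_abs, hσ2, one_pow]
  refine ⟨16 * Real.pi * C * 4, by positivity, fun n hn => ?_⟩
  have hn0 : (0 : ℝ) < n := by exact_mod_cast hn
  -- With this shift the harmonics are `sin(ky)`, non-negative for `k ≤ 4n`. For `2n ≤ k ≤ 3n` the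
  -- angle lies in `[π/2, 3π/4]`, so the sine is at least `1/2` and the Fejér factor at least `1/4`:
  -- `κ = 1/8`.
  set y := Real.pi / (4 * n) with hy
  have hy0 : 0 < y := by positivity
  have hny : n * y = Real.pi / 4 := by rw [hy]; field_simp
  have hval : ∀ k : ℕ, σ * Real.cos (k * y + β * Real.pi / 2) = Real.sin (k * y) := by
    intro k
    rw [Real.cos_add, hcos]
    linear_combination Real.sin (k * y) * hσ2 - σ * Real.sin (k * y) * hσdef
  have h1 := ofReal_mul_sum_le_bestApprox_one (ψ := ψ) (β := β) (y := y) (κ := 1 / 8) (n := n)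
    (M := 3 * n) (N := 4 * n) hw.pos hσ hn (by lia) (by lia)
    (fun k hk => by
      rw [hval]
      have hk : (k : ℝ) ≤ 4 * n := by exact_mod_cast (mem_Ico.mp hk).2.le
      refine Real.sin_nonneg_of_nonneg_of_le_pi (by positivity) ?_
      nlinarith)
    (fun k hk => by
      rw [hval]
      have hk1 : 2 * (n : ℝ) ≤ k := by exact_mod_cast (mem_Ico.mp hk).1
      have hk2 : (k : ℝ) ≤ 3 * n := by exact_mod_cast (mem_Ico.mp hk).2.le
      have hsin : 1 / 2 ≤ Real.sin (k * y) := by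
        rw [← Real.sin_pi_sub]
        have h3 : Real.pi / 4 ≤ Real.pi - k * y := by nlinarith
        have h4 : Real.pi - k * y ≤ Real.pi / 2 := by nlinarith
        refine le_trans ?_ (Real.mul_le_sin (by linarith) h4)
        calc (1 : ℝ) / 2 = 2 / Real.pi * (Real.pi / 4) := by field_simp; norm_num
          _ ≤ _ := by gcongr
      have hfrac : (k : ℝ) / ((4 * n : ℕ) : ℝ) ≤ 3 / 4 := by
        push_cast
        rw [div_le_div_iff₀ (by positivity) four_pos]
        linarith
      nlinarith)
  have hsum : ψ n * n ≤ C * ∑ k ∈ Ico (2 * n) (3 * n), ψ k := by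
    calc ψ n * n = ∑ _k ∈ Ico (2 * n) (3 * n), ψ n := by
          rw [sum_const, Nat.card_Ico, nsmul_eq_mul, show 3 * n - 2 * n = n by lia, mul_comm]
      _ ≤ ∑ k ∈ Ico (2 * n) (3 * n), C * ψ k := sum_le_sum fun k hk => by
          obtain ⟨h2, h3⟩ := mem_Ico.mp hk
          exact hw.doubling n k hn (by lia) (by lia)
      _ = _ := (mul_sum _ _ _).symm
  refine (ENNReal.ofReal_le_ofReal (hsum.trans_eq (?_ : _ = 16 * Real.pi * C
    * (1 / 8 / (2 * Real.pi) * ∑ k ∈ Ico (2 * n) (3 * n), ψ k)))).trans ?_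
  · field_simp
    ring
  · rw [ENNReal.ofReal_mul (by positivity)]
    refine (mul_le_mul_right h1 _).trans_eq ?_
    rw [← mul_assoc, ← ENNReal.ofReal_mul (by positivity)]

theorem exists_tail_le_tsum {ψ : ℝ → ℝ} {β C : ℝ} (hw : RegularWeight (fun k => ψ k) 1 C)
    (hs : Summable fun k : ℕ => ψ ((k + 1 : ℕ) : ℝ)) :
    ∃ D : ℝ, 0 < D ∧ ∀ n N : ℕ, 1 ≤ n → ∀ u : ℝ,
      |∑ k ∈ Ico n N, taper N k * ψ k * Real.cos (k * u - β * Real.pi / 2)|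
        ≤ D * ∑' j : ℕ, ψ ((n + j : ℕ) : ℝ) := by
  refine ⟨1, one_pos, fun n N hn u => ?_⟩
  rw [one_mul]
  refine le_trans ?_ (sum_Ico_le_tsum (h := fun k : ℕ => ψ k) hs (fun k hk => (hw.pos k hk).le)
    hn N)
  refine (abs_sum_le_sum_abs _ _).trans (sum_le_sum fun k hk => ?_)
  have hk := hn.trans (mem_Ico.mp hk).1
  rw [abs_mul, abs_of_nonneg (taper_mul_nonneg hw N hk)]
  exact (mul_le_of_le_one_right (taper_mul_nonneg hw N hk) (Real.abs_cos_le_one _)).trans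
    (taper_mul_le hw N hk)

/-- The kernel degenerates to a sine sum times `sin(βπ/2)`, and `kψ(k)` is non-increasing; a sine
sum with such coefficients is bounded by its leading size `nψ(n)`, with no need for absolute
summation. -/
theorem exists_tail_le_of_cos_eq_zero {ψ : ℝ → ℝ} {β C : ℝ}
    (hw : RegularWeight (fun k => ψ k) 1 C) (hcos : Real.cos (β * Real.pi / 2) = 0) :
    ∃ D : ℝ, 0 < D ∧ ∀ n N : ℕ, 1 ≤ n → ∀ u : ℝ,
      |∑ k ∈ Ico n N, taper N k * ψ k * Real.cos (k * u - β * Real.pi / 2)| ≤ D * (ψ n * n) := by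
  refine ⟨6, by norm_num, fun n N hn u => ?_⟩
  have hn0 : (0 : ℝ) < n := by exact_mod_cast hn
  have hanti : ∀ k : ℕ, n ≤ k → k * ψ k ≤ n * ψ n := by
    intro k hk
    induction k, hk using Nat.le_induction with
    | base => exact le_rfl
    | succ k hk ih =>
      have := hw.mul_rpow_antitone k (hn.trans hk)
      simp only [Real.rpow_one] at this
      linarith
  have h1 := abs_sum_mul_sin_le (c := fun k => taper N k * ψ k) N hn
    (fun k hk => taper_mul_nonneg hw N (hn.trans hk))
    (fun k hk => taper_mul_antitone hw zero_le_one N (hn.trans hk))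
    (fun k hk => by
      have h2 := mul_le_mul (taper_antitone N hk) (hanti k hk)
        (mul_nonneg (Nat.cast_nonneg k) (hw.pos k (hn.trans hk)).le) (taper_nonneg N n)
      linarith) u
  have h2 : ∑ k ∈ Ico n N, taper N k * ψ k * Real.cos (k * u - β * Real.pi / 2)
      = (∑ k ∈ Ico n N, taper N k * ψ k * Real.sin (k * u)) * Real.sin (β * Real.pi / 2) := by
    rw [sum_mul]
    refine sum_congr rfl fun k _ => ?_
    rw [Real.cos_sub, hcos]
    ring
  rw [h2, abs_mul]
  refine (mul_le_of_le_one_right (abs_nonneg _) (Real.abs_sin_le_one _)).trans (h1.trans ?_)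
  have h3 := taper_mul_le hw N hn
  calc 6 * (n * (taper N n * ψ n)) ≤ 6 * (n * ψ n) := by gcongr
    _ = _ := by ring

end FejerApprox

/-! ### Assembly of the two cases -/

open FejerApprox
theorem proposition1 (p : ℝ) (hp : 1 ≤ p) (ψ : ℝ → ℝ) (β : ℝ)
    (hM : ClassM0 (powerWeight ψ (1 / p)))
    (hGM : GMPlus (fun k : ℕ => powerWeight ψ (1 + 1 / p) k))
    (hGA : GAPlus (fun k : ℕ => powerWeight ψ (1 + 1 / p) k)) :
    (1 < p → ∀ q : ℝ, 1 / p + 1 / q = 1 →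
      Summable (fun k : ℕ => ψ ((k + 1 : ℕ) : ℝ) ^ q * ((k + 1 : ℕ) : ℝ) ^ (q - 2)) →
      q / 2 < ⨅ t : Set.Ici (1 : ℝ), alpha (powerWeight ψ (1 / p)) t →
      SameOrder (bestApprox (psiBetaClass ψ β p)) (fejerDeviation (psiBetaClass ψ β p)) ∧
      SameOrder (fejerDeviation (psiBetaClass ψ β p))
        (fun n => ENNReal.ofReal
          ((∑' j : ℕ, ψ ((n + j : ℕ) : ℝ) ^ q * ((n + j : ℕ) : ℝ) ^ (q - 2)) ^ (1 / q)))) ∧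
    (p = 1 →
      Summable (fun k : ℕ => ψ ((k + 1 : ℕ) : ℝ)) →
      1 < ⨅ t : Set.Ici (1 : ℝ), alpha (powerWeight ψ 1) t →
      SameOrder (bestApprox (psiBetaClass ψ β 1)) (fejerDeviation (psiBetaClass ψ β 1)) ∧
      (Real.cos (β * Real.pi / 2) ≠ 0 →
        SameOrder (fejerDeviation (psiBetaClass ψ β 1))
          (fun n => ENNReal.ofReal (∑' j : ℕ, ψ ((n + j : ℕ) : ℝ)))) ∧
      (Real.cos (β * Real.pi / 2) = 0 →
        SameOrder (fejerDeviation (psiBetaClass ψ β 1))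
          (fun n => ENNReal.ofReal (ψ n * n)))) := by
  have hp0 : 0 ≤ 1 / p := one_div_nonneg.mpr (by linarith)
  obtain ⟨C, hw⟩ := exists_regularWeight hp0 hM.1 hGA
  refine ⟨fun hp1 q hq hs _ => ?_, fun hp1 hs _ => ?_⟩
  · have hpq : p.HolderConjugate q := Real.holderConjugate_iff.mpr ⟨hp1, by simpa using hq⟩
    exact sameOrder_of_bounds (bestApprox_le_fejerDeviation _)
      (exists_fejerDeviation_le hpq hw hs) (exists_le_bestApprox hpq hw hs)
  · subst hp1
    rw [div_one] at hw
    have hcosne : Real.cos (β * Real.pi / 2) ≠ 0 →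
        SameOrder (bestApprox (psiBetaClass ψ β 1)) (fejerDeviation (psiBetaClass ψ β 1)) ∧
        SameOrder (fejerDeviation (psiBetaClass ψ β 1))
          (fun n => ENNReal.ofReal (∑' j : ℕ, ψ ((n + j : ℕ) : ℝ))) := fun hcos => by
      refine sameOrder_of_bounds (bestApprox_le_fejerDeviation _)
        (exists_fejerDeviation_one_le hw ?_ (exists_tail_le_tsum hw hs))
        (exists_le_bestApprox_one_of_cos_ne_zero hw hs hcos)
      have hreg := hw.dyadicRegular zero_le_one
      refine ⟨max C 1, hreg.const_pos, fun n hn => (hreg.mul_le_sum hn le_rfl).trans ?_⟩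
      exact mul_le_mul_of_nonneg_left
        (sum_Ico_le_tsum (h := fun k : ℕ => ψ k) hs hreg.nonneg hn _) hreg.const_pos.le
    have hcosz : Real.cos (β * Real.pi / 2) = 0 →
        SameOrder (bestApprox (psiBetaClass ψ β 1)) (fejerDeviation (psiBetaClass ψ β 1)) ∧
        SameOrder (fejerDeviation (psiBetaClass ψ β 1)) (fun n => ENNReal.ofReal (ψ n * n)) :=
      fun hcos => sameOrder_of_bounds (bestApprox_le_fejerDeviation _)
        (exists_fejerDeviation_one_le hw
          ⟨1, one_pos, fun n _ => by rw [one_mul, mul_comm]⟩ (exists_tail_le_of_cos_eq_zero hw hcos))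
        (exists_le_bestApprox_one_of_cos_eq_zero hw hcos)
    refine ⟨?_, fun hcos => (hcosne hcos).2, fun hcos => (hcosz hcos).2⟩
    -- The first comparison does not mention `β`, yet it is obtained through a different
    -- intermediate quantity in each case.
    by_cases hcos : Real.cos (β * Real.pi / 2) = 0
    · exact (hcosz hcos).1
    · exact (hcosne hcos).1
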